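/- For a permutation $\pi=\pi_1\cdots\pi_n$ of $\{1,\dots,n\}$, let $G_\pi$ be the grid graph with vertex set $\{(i,j): 1\le i\le n,\ 1\le j\le \pi_i\}$, in which $(i,j)$ and $(i',j')$ are adjacent if and only if either $i=i'$ and $|j-j'|=1$, or $|i-i'|=1$ and $j=j'$. Let $\mathrm{Av}_n(213)$ be the set of permutations $\pi$ of $\{1,\dots,n\}$ that avoid the pattern $213$, i.e. for which there are no positions $i<j<k$ with $\pi_j<\pi_i<\pi_k$. For $r\in\{1,2,3,4\}$ put \[ Q_r(n)=\sum_{\pi\in\mathrm{Av}_n(213)}\#\{v\in V(G_\pi):\deg(v)=r\},\qquad V_n=\frac n2\binom{2n}{n}. \] Then $V_n=\sum_{\pi\in\mathrm{Av}_n(213)}|V(G_\pi)|$ is the total number of vertices for every $n\ge 0$, and, as $n\to\infty$, \begin{align*} \frac{Q_1(n)}{V_n}&=\frac1{2n}+O(n^{-2}), & \frac{Q_2(n)}{V_n}&=\frac{\sqrt\pi}{8}\,n^{-1/2}+O(n^{-1}),\\ \frac{Q_3(n)}{V_n}&=\frac{3\sqrt\pi}{4}\,n^{-1/2}+O(n^{-1}),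 & \frac{Q_4(n)}{V_n}&=1-\frac{7\sqrt\pi}{8}\,n^{-1/2}+O(n^{-1}), \end{align*} where $\sqrt\pi$ denotes the square root of the circle constant. In particular, the proportion $Q_4(n)/V_n$ of degree-$4$ vertices tends to $1$. -/

import Mathlib

open Asymptotics

/-- The permutation `π` of `{0, …, n-1}` (in one-line notation `π 0, π 1, …`) avoids the
pattern `213`: there are no positions `i < j < k` with `π j < π i < π k`. -/
def Avoids213 {n : ℕ} (π : Equiv.Perm (Fin n)) : Prop :=
  ¬ ∃ i j k : Fin n, i < j ∧ j < k ∧ π j < π i ∧ π i < π k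

instance Avoids213.instDecidablePred {n : ℕ} : DecidablePred (Avoids213 (n := n)) :=
  fun π => by unfold Avoids213; infer_instance

/-- The set of `213`-avoiding permutations of size `n`. -/
def av213 (n : ℕ) : Finset (Equiv.Perm (Fin n)) :=
  Finset.univ.filter Avoids213

/-- Vertices of the grid graph of `π`: column `i` has `π_i` cells, one at each of the levels
`1, …, π_i`. Positions, values and levels are all shifted down by one, so the pair `(i, j)` of
elements of `Fin n` stands for the usual `(i + 1, j + 1)`, and `j + 1 ≤ π_{i+1}` reads
`j ≤ π i`. -/
abbrev GridVertex {n : ℕ} (π : Equiv.Perm (Fin n)) : Type :=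
  {p : Fin n × Fin n // p.2 ≤ π p.1}

/-- `a` and `b` differ by exactly one. -/
def Consecutive {n : ℕ} (a b : Fin n) : Prop :=
  (a : ℕ) + 1 = (b : ℕ) ∨ (b : ℕ) + 1 = (a : ℕ)

instance Consecutive.instDecidable {n : ℕ} (a b : Fin n) : Decidable (Consecutive a b) := by
  unfold Consecutive; infer_instance

/-- The grid graph of `π`: vertical edges join consecutive levels of one column, horizontal
edges join equal levels of consecutive columns. -/
def gridGraph {n : ℕ} (π : Equiv.Perm (Fin n)) : SimpleGraph (GridVertex π) where
  Adj u v :=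
    (u.1.1 = v.1.1 ∧ Consecutive u.1.2 v.1.2) ∨ (Consecutive u.1.1 v.1.1 ∧ u.1.2 = v.1.2)
  symm := ⟨by
    rintro u v (⟨h₁, h₂⟩ | ⟨h₁, h₂⟩)
    · exact Or.inl ⟨h₁.symm, h₂.symm⟩
    · exact Or.inr ⟨h₁.symm, h₂.symm⟩⟩
  loopless := ⟨by
    rintro u (⟨-, h⟩ | ⟨h, -⟩) <;> · unfold Consecutive at h; omega⟩

instance gridGraph.instDecidableRel {n : ℕ} (π : Equiv.Perm (Fin n)) :
    DecidableRel (gridGraph π).Adj :=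
  fun u v => by unfold gridGraph; infer_instance

/-- `degreeTotal r n` is the number `Q_r(n)` of vertices of degree `r`, summed over the grid
graphs of all `213`-avoiding permutations of size `n`. -/
def degreeTotal (r n : ℕ) : ℕ :=
  ∑ π ∈ av213 n, (Finset.univ.filter fun v : GridVertex π => (gridGraph π).degree v = r).card

/-- The number of vertices, summed over the grid graphs of all `213`-avoiding permutations of
size `n`. -/
def vertexTotal (n : ℕ) : ℕ :=
  ∑ π ∈ av213 n, Fintype.card (GridVertex π)

/-- `V_n = (n / 2) * B_n` with `B_n = binom(2n, n)`. -/
noncomputable def gridV (n : ℕ) : ℝ :=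
  (n : ℝ) / 2 * (Nat.choose (2 * n) n : ℝ)

/-! In a `213`-avoiding word every letter left of the minimum exceeds every letter right of it.
Splitting at the minimum therefore gives a bijection with binary trees (`exists_treeWord_eq`,
`sum_av213`), and every total becomes a sum over trees with `n` nodes, of which there are Catalan
many.

In a column that is neither first nor last, a cell strictly between bottom and top has both vertical
neighbours, so its degree depends only on how many of the two adjacent columns reach its level. Up
to two cells per column, degree 2 counts the height `peakHeight` above both neighbours, degree 3
counts `exposedHeight - 2 * peakHeight`, and degree 4 counts the whole column minus `exposedHeight -
peakHeight`. Degree 1 is exactly a strict local maximum. Bounded errors in the interior columns and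
errors at most `n` in the two end columns add up to `O(n * catalan n)`, which is `O(B_n)` with `B_n
= binom(2n, n)`.

Sums over consecutive triples are additive at the root of a tree apart from the triples that touch
the root (`tripleSum_node`). With `C` and `B` the Catalan and central binomial series, this makes
each generating function `X * B` times a series in `C` and `B` (`treeSeries_eq_of_node`). Reducing
by the algebraic relations leaves `B ^ 2 / 16` for peak height and `B ^ 2 / 2` for exposed height,
modulo series with coefficients `O(B_n)`, and `B / 4` to leading order for peaks. Since `B ^ 2 = 1 /
(1 - 4X)`, the totals for degrees 2, 3, 4 are `4^n / 16`, `3 * 4^n / 8` and `V_n - 7 * 4^n / 16`, up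
to `O(B_n)`. Division by `V_n = n * B_n / 2` and the Wallis estimate `4^n / B_n = √(π n) + O(1)`
finish the proof. -/

open BinaryTree Finset
open PowerSeries (coeff X)

/-! ### Binary trees and `213`-avoiding permutations. -/

/-- The word of a binary tree: the word of the left subtree, raised above everything else, then
the minimum `0`, then the word of the right subtree raised by one. -/
def treeWord : BinaryTree Unit → ℕ → ℕ
  | .nil, _ => 0
  | .node _ L R, i =>
    if i < L.numNodes then treeWord L i + (R.numNodes + 1)
    else if i = L.numNodes then 0 else treeWord R (i - (L.numNodes + 1)) + 1

theorem treeWord_node_left (u : Unit) (L R : BinaryTree Unit) {i : ℕ} (h : i < L.numNodes) :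
    treeWord (.node u L R) i = treeWord L i + (R.numNodes + 1) := by
  simp [treeWord, h]

theorem treeWord_node_root (u : Unit) (L R : BinaryTree Unit) :
    treeWord (.node u L R) L.numNodes = 0 := by
  simp [treeWord]

theorem treeWord_node_right (u : Unit) (L R : BinaryTree Unit) (i : ℕ) :
    treeWord (.node u L R) (L.numNodes + 1 + i) = treeWord R i + 1 := by
  have h₁ : ¬ L.numNodes + 1 + i < L.numNodes := by omega
  have h₂ : ¬ L.numNodes + 1 + i = L.numNodes := by omega
  simp [treeWord, h₁, h₂]

theorem treeWord_lt (t : BinaryTree Unit) : ∀ i < t.numNodes, treeWord t i < t.numNodes := by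
  induction t with
  | nil => simp
  | node u L R hL hR =>
    intro i hi
    simp only [numNodes] at hi
    simp only [treeWord, numNodes]
    split_ifs with h₁ h₂
    · have := hL i h₁; omega
    · omega
    · have := hR (i - (L.numNodes + 1)) (by omega); omega

theorem treeWord_inj (t : BinaryTree Unit) : ∀ i < t.numNodes, ∀ j < t.numNodes,
    treeWord t i = treeWord t j → i = j := by
  induction t with
  | nil => simp
  | node u L R hL hR =>
    intro i hi j hj
    simp only [numNodes] at hi hj
    have hRi := treeWord_lt R (i - (L.numNodes + 1))
    have hRj := treeWord_lt R (j - (L.numNodes + 1))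
    have hLL := fun h => hL i h j
    have hRR := fun h => hR (i - (L.numNodes + 1)) h (j - (L.numNodes + 1))
    intro h
    simp only [treeWord] at h
    split_ifs at h <;> omega

theorem treeWord_avoids (t : BinaryTree Unit) : ∀ i j k : ℕ, i < j → j < k → k < t.numNodes →
    ¬ (treeWord t j < treeWord t i ∧ treeWord t i < treeWord t k) := by
  induction t with
  | nil => simp
  | node u L R hL hR =>
    rintro i j k hij hjk hk ⟨h, h'⟩
    simp only [numNodes] at hk
    have hRk := treeWord_lt R (k - (L.numNodes + 1))
    have hLL := hL i j k hij hjk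
    have hRR := hR (i - (L.numNodes + 1)) (j - (L.numNodes + 1)) (k - (L.numNodes + 1))
    simp only [treeWord] at h h'
    split_ifs at h h' <;> omega

/-- The position of the letter `0` is the size of the left subtree, so the word determines the tree
recursively. -/
theorem eq_of_treeWord_eq (t : BinaryTree Unit) : ∀ t' : BinaryTree Unit,
    t.numNodes = t'.numNodes → (∀ i < t.numNodes, treeWord t i = treeWord t' i) → t = t' := by
  induction t with
  | nil =>
    intro t' h _
    cases t' with
    | nil => rfl
    | node => simp at h
  | node u L R hL hR =>
    intro t' h hw
    cases t' with
    | nil => simp at h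
    | node u' L' R' =>
      simp only [numNodes] at h hw
      have ha : L.numNodes = L'.numNodes := by
        refine treeWord_inj (.node u' L' R') _ (by simp only [numNodes]; omega) _
          (by simp only [numNodes]; omega) ?_
        rw [← hw _ (by omega), treeWord_node_root, treeWord_node_root]
      have hb : R.numNodes = R'.numNodes := by omega
      congr 1
      · refine hL L' ha fun i hi => ?_
        have := hw i (by omega)
        rw [treeWord_node_left _ _ _ hi, treeWord_node_left _ _ _ (ha ▸ hi)] at this
        omega
      · refine hR R' hb fun i hi => ?_
        have := hw (L.numNodes + 1 + i) (by omega)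
        rw [treeWord_node_right, ha, treeWord_node_right] at this
        omega

/-- Every `213`-avoiding word that lists `0, …, n - 1` is the word of a binary tree. -/
theorem exists_treeWord_eq (n : ℕ) : ∀ f : ℕ → ℕ, (∀ i < n, f i < n) →
    (∀ i < n, ∀ j < n, f i = f j → i = j) →
    (∀ i j k : ℕ, i < j → j < k → k < n → ¬ (f j < f i ∧ f i < f k)) →
    ∃ t : BinaryTree Unit, t.numNodes = n ∧ ∀ i < n, treeWord t i = f i := by
  induction n using Nat.strong_induction_on with
  | _ n ih =>
  intro f hlt hinj hav
  rcases Nat.eq_zero_or_pos n with rfl | hn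
  · exact ⟨.nil, rfl, by simp⟩
  obtain ⟨a, ha, ha0⟩ : ∃ a < n, f a = 0 := by
    have := Finset.surjOn_of_injOn_of_card_le (s := range n) (t := range n) f
      (fun i hi => by simpa using hlt i (by simpa using hi))
      (fun i hi j hj h => hinj i (by simpa using hi) j (by simpa using hj) h) le_rfl
    obtain ⟨a, ha, h⟩ := this (by simpa using hn : (0 : ℕ) ∈ (range n : Set ℕ))
    exact ⟨a, by simpa using ha, h⟩
  obtain ⟨b, rfl⟩ : ∃ b, n = a + 1 + b := ⟨n - (a + 1), by omega⟩
  have hpos : ∀ i < a + 1 + b, i ≠ a → 0 < f i := by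
    intro i hi hne
    rcases Nat.eq_zero_or_pos (f i) with h | h
    · exact absurd (hinj i hi a ha (by omega)) hne
    · exact h
  -- Otherwise positions `i < a < k` would form a `213` whose smallest letter is the minimum.
  have hsep : ∀ i < a, ∀ k, a < k → k < a + 1 + b → f k < f i := by
    intro i hi k hk hk'
    have h₁ := hav i a k hi hk hk'
    have h₂ := hpos i (by omega) (by omega)
    have h₃ : f i ≠ f k := fun h => by have := hinj i (by omega) k hk' h; omega
    omega
  -- The `b + 1` distinct letters at positions `a, …, a + b` all lie below `f i`.
  have hleft : ∀ i < a, b + 1 ≤ f i := by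
    intro i hi
    have : (Ico a (a + 1 + b)).card ≤ (range (f i)).card := by
      refine card_le_card_of_injOn f (fun k hk => ?_) (fun k hk k' hk' h => ?_)
      · simp only [coe_Ico, Set.mem_Ico] at hk
        simp only [coe_range, Set.mem_Iio]
        rcases eq_or_lt_of_le hk.1 with rfl | h
        · rw [ha0]; exact hpos i (by omega) (by omega)
        · exact hsep i hi k h hk.2
      · simp only [coe_Ico, Set.mem_Ico] at hk hk'
        exact hinj k hk.2 k' hk'.2 h
    simp at this
    omega
  -- Dually, the `a` letters left of the minimum are distinct and lie strictly between `f k` and `a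
  -- + 1 + b`.
  have hright : ∀ k, a < k → k < a + 1 + b → f k ≤ b := by
    intro k hk hk'
    have : (range a).card ≤ (Ioo (f k) (a + 1 + b)).card := by
      refine card_le_card_of_injOn f (fun i hi => ?_) (fun i hi i' hi' h => ?_)
      · simp only [coe_range, Set.mem_Iio] at hi
        simp only [coe_Ioo, Set.mem_Ioo]
        exact ⟨hsep i hi k hk hk', hlt i (by omega)⟩
      · simp only [coe_range, Set.mem_Iio] at hi hi'
        exact hinj i (by omega) i' (by omega) h
    simp at this
    have := hlt k hk'
    omega
  obtain ⟨L, hLn, hL⟩ := ih a (by omega) (fun i => f i - (b + 1))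
    (fun i hi => by have := hleft i hi; have := hlt i (by omega); omega)
    (fun i hi j hj h => by
      have h₁ := hleft i hi
      have h₂ := hleft j hj
      exact hinj i (by omega) j (by omega) (by omega))
    (fun i j k hij hjk hk => by
      have h₁ := hav i j k hij hjk (by omega)
      omega)
  obtain ⟨R, hRn, hR⟩ := ih b (by omega) (fun i => f (a + 1 + i) - 1)
    (fun i hi => by
      have h₁ := hright (a + 1 + i) (by omega) (by omega)
      have h₂ := hpos (a + 1 + i) (by omega) (by omega)
      omega)
    (fun i hi j hj h => by
      have h₁ := hpos (a + 1 + i) (by omega) (by omega)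
      have h₂ := hpos (a + 1 + j) (by omega) (by omega)
      have := hinj (a + 1 + i) (by omega) (a + 1 + j) (by omega) (by omega)
      omega)
    (fun i j k hij hjk hk => by
      have h₁ := hav (a + 1 + i) (a + 1 + j) (a + 1 + k) (by omega) (by omega) (by omega)
      omega)
  refine ⟨.node () L R, by simp only [numNodes]; omega, fun i hi => ?_⟩
  rcases lt_trichotomy i a with h | rfl | h
  · rw [treeWord_node_left _ _ _ (by omega), hL i h, hRn]
    have := hleft i h
    omega
  · have := treeWord_node_root () L R
    rw [hLn] at this
    rw [this, ha0]
  · obtain ⟨k, rfl⟩ : ∃ k, i = a + 1 + k := ⟨i - (a + 1), by omega⟩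
    have := treeWord_node_right () L R k
    rw [hLn] at this
    have h₂ := hpos (a + 1 + k) (by omega) (by omega)
    rw [this, hR k (by omega)]
    omega

theorem exists_tree_of_mem_av213 {n : ℕ} {π : Equiv.Perm (Fin n)} (hπ : π ∈ av213 n) :
    ∃ t : BinaryTree Unit, t.numNodes = n ∧ ∀ i : Fin n, treeWord t i = π i := by
  have hav : Avoids213 π := (mem_filter.1 hπ).2
  obtain ⟨t, ht, hw⟩ := exists_treeWord_eq n (fun i => if h : i < n then π ⟨i, h⟩ else 0)
    (fun i hi => by simp [hi])
    (fun i hi j hj h => by simpa [hi, hj, ← Fin.ext_iff] using h)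
    (fun i j k hij hjk hk => by
      have hj : j < n := by omega
      have hi : i < n := by omega
      simp only [hi, hj, hk, dif_pos]
      rintro ⟨h₁, h₂⟩
      exact hav ⟨⟨i, hi⟩, ⟨j, hj⟩, ⟨k, hk⟩, hij, hjk, h₁, h₂⟩)
  exact ⟨t, ht, fun i => by simp [hw i i.2]⟩

/-- Sums over `213`-avoiding permutations are sums over binary trees. -/
theorem sum_av213 {M : Type*} [AddCommMonoid M] (n : ℕ) (F : Equiv.Perm (Fin n) → M)
    (G : BinaryTree Unit → M)
    (h : ∀ (π : Equiv.Perm (Fin n)) (t : BinaryTree Unit), t.numNodes = n →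
      (∀ i : Fin n, treeWord t i = π i) → F π = G t) :
    ∑ π ∈ av213 n, F π = ∑ t ∈ treesOfNumNodesEq n, G t := by
  refine sum_bij (fun π hπ => (exists_tree_of_mem_av213 hπ).choose) (fun π hπ => ?_)
    (fun π hπ π' hπ' he => ?_) (fun t ht => ?_) (fun π hπ => ?_)
  · exact mem_treesOfNumNodesEq.2 (exists_tree_of_mem_av213 hπ).choose_spec.1
  · ext i
    rw [← (exists_tree_of_mem_av213 hπ).choose_spec.2 i,
      ← (exists_tree_of_mem_av213 hπ').choose_spec.2 i]
    exact congrArg (fun t => treeWord t i) he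
  · obtain rfl := mem_treesOfNumNodesEq.1 ht
    let g : Fin t.numNodes → Fin t.numNodes := fun i => ⟨treeWord t i, treeWord_lt t i i.2⟩
    have hg : Function.Injective g := fun i j hij =>
      Fin.ext (treeWord_inj t i i.2 j j.2 (Fin.ext_iff.1 hij))
    let π : Equiv.Perm (Fin t.numNodes) := Equiv.ofBijective g (Finite.injective_iff_bijective.1 hg)
    have hπ : ∀ i, (π i : ℕ) = treeWord t i := fun i => rfl
    have hmem : π ∈ av213 t.numNodes := by
      refine mem_filter.2 ⟨mem_univ _, ?_⟩
      rintro ⟨i, j, k, hij, hjk, h₁, h₂⟩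
      exact treeWord_avoids t i j k hij hjk k.2 ⟨h₁, h₂⟩
    refine ⟨π, hmem, ?_⟩
    obtain ⟨h₁, h₂⟩ := (exists_tree_of_mem_av213 hmem).choose_spec
    refine eq_of_treeWord_eq _ _ h₁ fun i hi => ?_
    rw [h₁] at hi
    rw [h₂ ⟨i, hi⟩, hπ]
  · exact h _ _ (exists_tree_of_mem_av213 hπ).choose_spec.1
      (exists_tree_of_mem_av213 hπ).choose_spec.2

theorem card_av213 (n : ℕ) : (av213 n).card = catalan n := by
  rw [card_eq_sum_ones, sum_av213 n (fun _ => 1) (fun _ => 1) (fun _ _ _ _ => rfl),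
    ← card_eq_sum_ones, treesOfNumNodesEq_card_eq_catalan]

/-! ### Degrees of cells, counted column by column. -/

theorem card_filter_eq_ite {α : Type*} [Fintype α] (p : α → Prop) [DecidablePred p] (c : Prop)
    [Decidable c] (h₁ : c → ∃ x, p x) (h₂ : ∀ x, p x → c) (h₃ : ∀ x y, p x → p y → x = y) :
    (univ.filter p).card = if c then 1 else 0 := by
  split_ifs with hc
  · obtain ⟨x, hx⟩ := h₁ hc
    refine card_eq_one.2 ⟨x, ?_⟩
    ext y
    simp only [mem_filter, mem_univ, true_and, mem_singleton]
    exact ⟨fun hy => h₃ y x hy hx, fun h => h ▸ hx⟩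
  · refine card_eq_zero.2 (filter_eq_empty_iff.2 fun x _ hx => hc (h₂ x hx))

/-- The degree of the cell `(i, j)` in the grid graph of a word `w` of length `n`: the number of
those of its four neighbours (below, above, left, right) that are present. -/
def cellDegree (n : ℕ) (w : ℕ → ℕ) (i j : ℕ) : ℕ :=
  (if 0 < j then 1 else 0) + (if j < w i then 1 else 0) +
    (if 0 < i ∧ j ≤ w (i - 1) then 1 else 0) + (if i + 1 < n ∧ j ≤ w (i + 1) then 1 else 0)

theorem gridGraph_degree {n : ℕ} (π : Equiv.Perm (Fin n)) (w : ℕ → ℕ)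
    (hw : ∀ i : Fin n, w i = π i) (v : GridVertex π) :
    (gridGraph π).degree v = cellDegree n w v.1.1 v.1.2 := by
  classical
  obtain ⟨⟨i, j⟩, hv⟩ := v
  have hv' : (j : ℕ) ≤ π i := hv
  have hval : ∀ x y : GridVertex π, (x.1.1 : ℕ) = y.1.1 → (x.1.2 : ℕ) = y.1.2 → x = y :=
    fun x y h₁ h₂ => Subtype.ext (Prod.ext (Fin.ext h₁) (Fin.ext h₂))
  let p₁ : GridVertex π → Prop := fun x => (x.1.1 : ℕ) = i ∧ (x.1.2 : ℕ) + 1 = j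
  let p₂ : GridVertex π → Prop := fun x => (x.1.1 : ℕ) = i ∧ (x.1.2 : ℕ) = j + 1
  let p₃ : GridVertex π → Prop := fun x => (x.1.1 : ℕ) + 1 = i ∧ (x.1.2 : ℕ) = j
  let p₄ : GridVertex π → Prop := fun x => (x.1.1 : ℕ) = i + 1 ∧ (x.1.2 : ℕ) = j
  -- Neighbours sorted by direction: below, above, left, right. Each class has at most one element,
  -- matching one summand of `cellDegree`.
  have hsplit : (gridGraph π).neighborFinset ⟨(i, j), hv⟩ =
      ((univ.filter p₁ ∪ univ.filter p₂) ∪ univ.filter p₃) ∪ univ.filter p₄ := by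
    ext x
    rw [SimpleGraph.mem_neighborFinset]
    simp only [mem_union, mem_filter, mem_univ, true_and,
      gridGraph, Consecutive, Fin.ext_iff, p₁, p₂, p₃, p₄]
    omega
  rw [← SimpleGraph.card_neighborFinset_eq_degree, hsplit, card_union_of_disjoint,
    card_union_of_disjoint, card_union_of_disjoint, cellDegree]
  · congr 1
    · congr 1
      · congr 1
        · refine card_filter_eq_ite p₁ _ (fun h => ?_) (fun x hx => ?_) (fun x y hx hy => ?_)
          · refine ⟨⟨(i, ⟨j - 1, by omega⟩), ?_⟩, rfl, ?_⟩
            · exact Fin.le_def.2 (by dsimp only; omega)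
            · dsimp only at h ⊢; omega
          · dsimp only [p₁] at hx ⊢; omega
          · dsimp only [p₁] at hx hy
            exact hval x y (by omega) (by omega)
        · refine card_filter_eq_ite p₂ _ (fun h => ?_) (fun x hx => ?_) (fun x y hx hy => ?_)
          · dsimp only at h
            rw [hw] at h
            exact ⟨⟨(i, ⟨j + 1, by omega⟩), Fin.le_def.2 (by dsimp only; omega)⟩, rfl, rfl⟩
          · have h₁ : (x.1.2 : ℕ) ≤ π x.1.1 := x.2
            have h₂ : x.1.1 = i := Fin.ext hx.1
            rw [h₂] at h₁
            dsimp only [p₂] at hx ⊢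
            rw [hw]
            omega
          · dsimp only [p₂] at hx hy
            exact hval x y (by omega) (by omega)
      · refine card_filter_eq_ite p₃ _ (fun h => ?_) (fun x hx => ?_) (fun x y hx hy => ?_)
        · dsimp only at h
          have h' := hw ⟨i - 1, by omega⟩
          dsimp only at h'
          rw [h'] at h
          refine ⟨⟨(⟨i - 1, by omega⟩, j), Fin.le_def.2 h.2⟩, ?_, rfl⟩
          dsimp only
          omega
        · have h₁ : (x.1.2 : ℕ) ≤ π x.1.1 := x.2
          dsimp only [p₃] at hx ⊢
          have h₂ : (i : ℕ) - 1 = x.1.1 := by omega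
          rw [h₂, hw]
          omega
        · dsimp only [p₃] at hx hy
          exact hval x y (by omega) (by omega)
    · refine card_filter_eq_ite p₄ _ (fun h => ?_) (fun x hx => ?_) (fun x y hx hy => ?_)
      · dsimp only at h
        have h' := hw ⟨i + 1, h.1⟩
        dsimp only at h'
        rw [h'] at h
        exact ⟨⟨(⟨i + 1, h.1⟩, j), Fin.le_def.2 h.2⟩, rfl, rfl⟩
      · have h₁ : (x.1.2 : ℕ) ≤ π x.1.1 := x.2
        dsimp only [p₄] at hx ⊢
        rw [← hx.1, hw]
        omega
      · dsimp only [p₄] at hx hy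
        exact hval x y (by omega) (by omega)
  all_goals
    rw [disjoint_left]
    intro x
    simp only [mem_union, mem_filter, mem_univ, true_and, p₁, p₂, p₃, p₄]
    omega

/-- Cells of a grid graph, counted column by column. -/
theorem card_filter_gridVertex {n : ℕ} (π : Equiv.Perm (Fin n)) (w : ℕ → ℕ)
    (hw : ∀ i : Fin n, w i = π i) (p : ℕ → ℕ → Prop) [∀ i j, Decidable (p i j)] :
    (univ.filter fun v : GridVertex π => p v.1.1 v.1.2).card =
      ∑ i ∈ range n, ((range (w i + 1)).filter (p i)).card := by
  rw [← card_sigma]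
  refine card_bij (fun v _ => ⟨v.1.1, v.1.2⟩) (fun v hv => ?_) (fun v _ v' _ h => ?_)
    (fun x hx => ?_)
  · have h₁ : (v.1.2 : ℕ) ≤ π v.1.1 := v.2
    simp only [mem_filter, mem_univ, true_and] at hv
    simp only [mem_sigma, mem_range, mem_filter, hw]
    exact ⟨v.1.1.2, by omega, hv⟩
  · simp only [Sigma.mk.injEq, heq_eq_eq] at h
    exact Subtype.ext (Prod.ext (Fin.ext h.1) (Fin.ext h.2))
  · obtain ⟨i, j⟩ := x
    simp only [mem_sigma, mem_range, mem_filter] at hx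
    obtain ⟨hi, hj, hp⟩ := hx
    have h' := hw ⟨i, hi⟩
    dsimp only at h'
    rw [h'] at hj
    have hj' : j < n := by omega
    exact ⟨⟨(⟨i, hi⟩, ⟨j, hj'⟩), Fin.le_def.2 (by dsimp only; omega)⟩,
      by simpa using hp, rfl⟩

/-- The number of cells of degree `r` in column `i`. -/
def columnCount (r n : ℕ) (w : ℕ → ℕ) (i : ℕ) : ℕ :=
  ((range (w i + 1)).filter fun j => cellDegree n w i j = r).card

theorem degreeTotal_eq_sum_trees (r n : ℕ) :
    degreeTotal r n =
      ∑ t ∈ treesOfNumNodesEq n, ∑ i ∈ range n, columnCount r n (treeWord t) i := by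
  refine sum_av213 n _ _ fun π t _ hw => ?_
  simp only [gridGraph_degree π (treeWord t) hw]
  exact card_filter_gridVertex π (treeWord t) hw fun i j => cellDegree n (treeWord t) i j = r

/-- The column heights are a rearrangement of `1, …, n`, so all the grid graphs have equally many
cells. -/
theorem vertexTotal_eq (n : ℕ) : vertexTotal n = catalan n * (∑ i ∈ range n, (i + 1)) := by
  have h : ∀ π ∈ av213 n, Fintype.card (GridVertex π) = ∑ i ∈ range n, (i + 1) := by
    intro π _
    have := card_filter_gridVertex π (fun i => if h : i < n then π ⟨i, h⟩ else 0)
      (fun i => by simp) (fun _ _ => True)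
    simp only [filter_true, card_univ, card_range] at this
    rw [this, sum_range, sum_range, ← Equiv.sum_comp π (fun i => (i : ℕ) + 1)]
    simp
  rw [vertexTotal, sum_congr rfl h, sum_const, card_av213, smul_eq_mul]

theorem vertexTotal_eq_gridV (n : ℕ) : (vertexTotal n : ℝ) = gridV n := by
  have h₁ : (∑ i ∈ range n, (i + 1)) * 2 = (n + 1) * n := by
    rw [sum_add_distrib, add_mul, sum_range_id_mul_two]
    cases n <;> simp; ring
  have h₂ := succ_mul_catalan_eq_centralBinom n
  rw [Nat.centralBinom_eq_two_mul_choose] at h₂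
  rw [vertexTotal_eq, gridV, ← h₂]
  have h₃ : ((∑ i ∈ range n, (i + 1) : ℕ) : ℝ) * 2 = (n + 1) * n := by exact_mod_cast h₁
  push_cast at h₃ ⊢
  linear_combination (catalan n : ℝ) / 2 * h₃

theorem vertexTotal_eq_sum_trees (n : ℕ) :
    vertexTotal n = ∑ t ∈ treesOfNumNodesEq n, ∑ i ∈ range n, (treeWord t i + 1) := by
  refine sum_av213 n _ _ fun π t _ hw => ?_
  simpa using card_filter_gridVertex π (treeWord t) hw fun _ _ => True

/-! ### Degree counts in terms of three consecutive letters. -/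

/-- Indicator of a strict local maximum. -/
def peakIndicator (a b c : ℕ) : ℕ := if a < b ∧ c < b then 1 else 0

/-- The height by which `b` exceeds both of its neighbours. -/
def peakHeight (a b c : ℕ) : ℕ := b - max a c

/-- The total height by which `b` exceeds its neighbours. -/
def exposedHeight (a b c : ℕ) : ℕ := (b - a) + (b - c)

/-- The sum of `f` over consecutive triples of the word of a tree. -/
def tripleSum (f : ℕ → ℕ → ℕ → ℕ) (t : BinaryTree Unit) : ℝ :=
  ∑ i ∈ range (t.numNodes - 2), (f (treeWord t i) (treeWord t (i + 1)) (treeWord t (i + 2)) : ℝ)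

theorem card_le_card_add_two {A B : Finset ℕ} (a b : ℕ)
    (h : ∀ j ∈ A, j ≠ a → j ≠ b → j ∈ B) : A.card ≤ B.card + 2 := by
  have : A ⊆ B ∪ {a, b} := by
    intro j hj
    simp only [mem_union, mem_insert, mem_singleton]
    by_cases h₁ : j = a
    · exact Or.inr (Or.inl h₁)
    · by_cases h₂ : j = b
      · exact Or.inr (Or.inr h₂)
      · exact Or.inl (h j hj h₁ h₂)
  exact (card_le_card this).trans ((card_union_le _ _).trans (by gcongr; exact card_le_two))

theorem columnCount_le (r n : ℕ) (w : ℕ → ℕ) (i : ℕ) : columnCount r n w i ≤ w i + 1 :=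
  (card_filter_le _ _).trans (by simp)

/-- A cell strictly between bottom and top already has two vertical neighbours. -/
theorem columnCount_one_le (n : ℕ) (w : ℕ → ℕ) (i : ℕ) : columnCount 1 n w i ≤ 2 := by
  refine (card_le_card_add_two (B := ∅) 0 (w i) fun j hj h₁ h₂ => ?_).trans (by simp)
  rw [mem_filter, mem_range, cellDegree] at hj
  have h₃ : 0 < j := by omega
  have h₄ : j < w i := by omega
  simp only [h₃, h₄, if_true] at hj
  omega

section Interior

variable {n : ℕ} (w : ℕ → ℕ) (i : ℕ)

theorem cellDegree_interior (hn : i + 2 < n) (j : ℕ) :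
    cellDegree n w (i + 1) j = (if 0 < j then 1 else 0) + (if j < w (i + 1) then 1 else 0) +
      (if j ≤ w i then 1 else 0) + (if j ≤ w (i + 2) then 1 else 0) := by
  have h : i + 1 + 1 < n := hn
  simp [cellDegree, h]

/-- The bottom cell of an interior column has both horizontal neighbours, so only the top cell of a
strict peak has degree 1. Exactness matters: an error of constant size per column would be of the
order of the main term. -/
theorem columnCount_one_interior (hn : i + 2 < n) :
    columnCount 1 n w (i + 1) = peakIndicator (w i) (w (i + 1)) (w (i + 2)) := by
  rw [columnCount, peakIndicator]
  split_ifs with h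
  · refine card_eq_one.2 ⟨w (i + 1), ?_⟩
    ext j
    simp only [mem_filter, mem_range, mem_singleton, cellDegree_interior w i hn]
    constructor
    · rintro ⟨h₁, h₂⟩
      split_ifs at h₂ <;> omega
    · rintro rfl
      refine ⟨by omega, ?_⟩
      split_ifs <;> omega
  · refine card_eq_zero.2 (filter_eq_empty_iff.2 fun j hj hd => h ?_)
    simp only [mem_range] at hj
    rw [cellDegree_interior w i hn] at hd
    split_ifs at hd <;> omega

/-- The vertical neighbours contribute 2 except at the bottom and top cells, which account for the
error 2. -/
theorem columnCount_interior_compare (hn : i + 2 < n) (r : ℕ) (A : Finset ℕ)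
    (hA : ∀ j ∈ A, j ≤ w (i + 1))
    (h : ∀ j, 0 < j → j < w (i + 1) →
      (2 + (if j ≤ w i then 1 else 0) + (if j ≤ w (i + 2) then 1 else 0) = r ↔ j ∈ A)) :
    columnCount r n w (i + 1) ≤ A.card + 2 ∧ A.card ≤ columnCount r n w (i + 1) + 2 := by
  constructor
  · refine card_le_card_add_two 0 (w (i + 1)) fun j hj h₁ h₂ => ?_
    simp only [mem_filter, mem_range, cellDegree_interior w i hn] at hj
    have h₃ : 0 < j := by omega
    have h₄ : j < w (i + 1) := by omega
    simp only [h₃, h₄, if_true] at hj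
    exact (h j h₃ h₄).1 hj.2
  · refine card_le_card_add_two 0 (w (i + 1)) fun j hj h₁ h₂ => ?_
    have h₀ := hA j hj
    have h₃ : 0 < j := by omega
    have h₄ : j < w (i + 1) := by omega
    simp only [mem_filter, mem_range, cellDegree_interior w i hn, h₃, h₄, if_true]
    exact ⟨by omega, (h j h₃ h₄).2 hj⟩

theorem columnCount_two_interior (hn : i + 2 < n) :
    |(columnCount 2 n w (i + 1) : ℝ) - peakHeight (w i) (w (i + 1)) (w (i + 2))| ≤ 2 := by
  have := columnCount_interior_compare w i hn 2 (Ioc (max (w i) (w (i + 2))) (w (i + 1)))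
    (fun j hj => by simp at hj; omega) (fun j h₁ h₂ => by
      simp only [mem_Ioc]
      split_ifs <;> omega)
  rw [Nat.card_Ioc] at this
  rw [peakHeight, abs_le]
  constructor
  · have h : w (i + 1) - max (w i) (w (i + 2)) ≤ columnCount 2 n w (i + 1) + 2 := this.2
    have : ((w (i + 1) - max (w i) (w (i + 2)) : ℕ) : ℝ) ≤ columnCount 2 n w (i + 1) + 2 := by
      exact_mod_cast h
    linarith
  · have : (columnCount 2 n w (i + 1) : ℝ) ≤ (w (i + 1) - max (w i) (w (i + 2)) : ℕ) + 2 := by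
      exact_mod_cast this.1
    linarith

/-- The relevant levels lie above exactly one neighbour; `exposedHeight` counts levels above both
neighbours twice, so these are removed twice. -/
theorem columnCount_three_interior (hn : i + 2 < n) :
    |(columnCount 3 n w (i + 1) : ℝ) - (exposedHeight (w i) (w (i + 1)) (w (i + 2)) -
      2 * peakHeight (w i) (w (i + 1)) (w (i + 2)))| ≤ 2 := by
  have := columnCount_interior_compare w i hn 3
    (Ioc (min (w i) (w (i + 2))) (min (w (i + 1)) (max (w i) (w (i + 2)))))
    (fun j hj => by simp at hj; omega) (fun j h₁ h₂ => by
      simp only [mem_Ioc]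
      split_ifs <;> omega)
  rw [Nat.card_Ioc] at this
  have h₁ : columnCount 3 n w (i + 1) + 2 * peakHeight (w i) (w (i + 1)) (w (i + 2)) ≤
      exposedHeight (w i) (w (i + 1)) (w (i + 2)) + 2 := by
    unfold peakHeight exposedHeight; omega
  have h₂ : exposedHeight (w i) (w (i + 1)) (w (i + 2)) ≤
      columnCount 3 n w (i + 1) + 2 * peakHeight (w i) (w (i + 1)) (w (i + 2)) + 2 := by
    unfold peakHeight exposedHeight; omega
  have h₁' : (columnCount 3 n w (i + 1) : ℝ) + 2 * peakHeight (w i) (w (i + 1)) (w (i + 2)) ≤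
      exposedHeight (w i) (w (i + 1)) (w (i + 2)) + 2 := by exact_mod_cast h₁
  have h₂' : (exposedHeight (w i) (w (i + 1)) (w (i + 2)) : ℝ) ≤
      columnCount 3 n w (i + 1) + 2 * peakHeight (w i) (w (i + 1)) (w (i + 2)) + 2 := by
    exact_mod_cast h₂
  rw [abs_le]
  constructor <;> linarith

/-- By inclusion–exclusion, `exposedHeight - peakHeight` levels miss at least one horizontal
neighbour. -/
theorem columnCount_four_interior (hn : i + 2 < n) :
    |(columnCount 4 n w (i + 1) : ℝ) - (w (i + 1) + 1) -
      (peakHeight (w i) (w (i + 1)) (w (i + 2)) -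
        exposedHeight (w i) (w (i + 1)) (w (i + 2)))| ≤ 2 := by
  have := columnCount_interior_compare w i hn 4
    (range (min (w (i + 1)) (min (w i) (w (i + 2))) + 1))
    (fun j hj => by simp at hj; omega) (fun j h₁ h₂ => by
      simp only [mem_range]
      split_ifs <;> omega)
  rw [card_range] at this
  have h₁ : columnCount 4 n w (i + 1) + exposedHeight (w i) (w (i + 1)) (w (i + 2)) ≤
      w (i + 1) + 1 + peakHeight (w i) (w (i + 1)) (w (i + 2)) + 2 := by
    unfold peakHeight exposedHeight; omega
  have h₂ : w (i + 1) + 1 + peakHeight (w i) (w (i + 1)) (w (i + 2)) ≤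
      columnCount 4 n w (i + 1) + exposedHeight (w i) (w (i + 1)) (w (i + 2)) + 2 := by
    unfold peakHeight exposedHeight; omega
  have h₁' : (columnCount 4 n w (i + 1) : ℝ) + exposedHeight (w i) (w (i + 1)) (w (i + 2)) ≤
      w (i + 1) + 1 + peakHeight (w i) (w (i + 1)) (w (i + 2)) + 2 := by exact_mod_cast h₁
  have h₂' : (w (i + 1) : ℝ) + 1 + peakHeight (w i) (w (i + 1)) (w (i + 2)) ≤
      columnCount 4 n w (i + 1) + exposedHeight (w i) (w (i + 1)) (w (i + 2)) + 2 := by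
    exact_mod_cast h₂
  rw [abs_le]
  constructor <;> linarith

end Interior

theorem abs_sum_sub_sum_interior_le (a b : ℕ → ℝ) (m : ℕ) (K c : ℝ) (h₀ : |a 0| ≤ c)
    (h₁ : |a (m + 1)| ≤ c) (h : ∀ i < m, |a (i + 1) - b i| ≤ K) :
    |∑ i ∈ range (m + 2), a i - ∑ i ∈ range m, b i| ≤ K * m + 2 * c := by
  have hs : |∑ i ∈ range m, (a (i + 1) - b i)| ≤ K * m := by
    refine (abs_sum_le_sum_abs _ _).trans ?_
    refine (sum_le_sum fun i hi => h i (mem_range.1 hi)).trans ?_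
    simp [mul_comm]
  rw [sum_sub_distrib] at hs
  rw [sum_range_succ, sum_range_succ']
  rw [abs_le] at *
  constructor <;> linarith [h₀.1, h₀.2, h₁.1, h₁.2, hs.1, hs.2]

theorem abs_sum_trees_sub_le (n : ℕ) (F G : BinaryTree Unit → ℝ) (K : ℝ)
    (h : ∀ t : BinaryTree Unit, t.numNodes = n → |F t - G t| ≤ K) :
    |∑ t ∈ treesOfNumNodesEq n, F t - ∑ t ∈ treesOfNumNodesEq n, G t| ≤ catalan n * K := by
  rw [← sum_sub_distrib]
  refine (abs_sum_le_sum_abs _ _).trans ?_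
  refine (sum_le_sum fun t ht => h t (mem_treesOfNumNodesEq.1 ht)).trans ?_
  simp [treesOfNumNodesEq_card_eq_catalan]

theorem columnCount_treeWord_le {t : BinaryTree Unit} {n : ℕ} (ht : t.numNodes = n) (r : ℕ) {i : ℕ}
    (hi : i < n) : |(columnCount r n (treeWord t) i : ℝ)| ≤ n := by
  rw [Nat.abs_cast]
  have h₁ := columnCount_le r n (treeWord t) i
  have h₂ := treeWord_lt t i (by omega)
  exact_mod_cast (by omega : columnCount r n (treeWord t) i ≤ n)

theorem abs_degreeTotal_one_sub_le (n : ℕ) (hn : 2 ≤ n) :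
    |(degreeTotal 1 n : ℝ) - ∑ t ∈ treesOfNumNodesEq n, tripleSum peakIndicator t| ≤
      catalan n * 4 := by
  rw [degreeTotal_eq_sum_trees, Nat.cast_sum]
  refine abs_sum_trees_sub_le n _ _ _ fun t ht => ?_
  obtain ⟨m, rfl⟩ := Nat.exists_eq_add_of_le' hn
  rw [tripleSum, ht, Nat.cast_sum]
  have hend : ∀ i, |(columnCount 1 (m + 2) (treeWord t) i : ℝ)| ≤ 2 := fun i => by
    rw [Nat.abs_cast]
    exact_mod_cast columnCount_one_le (m + 2) (treeWord t) i
  have := abs_sum_sub_sum_interior_le (fun i => (columnCount 1 (m + 2) (treeWord t) i : ℝ))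
    (fun i => (peakIndicator (treeWord t i) (treeWord t (i + 1)) (treeWord t (i + 2)) : ℝ)) m 0 2
    (hend _) (hend _) (fun i hi => by
      rw [columnCount_one_interior _ _ (by omega)]; simp)
  norm_num at this ⊢
  exact this

theorem abs_degreeTotal_two_sub_le (n : ℕ) (hn : 2 ≤ n) :
    |(degreeTotal 2 n : ℝ) - ∑ t ∈ treesOfNumNodesEq n, tripleSum peakHeight t| ≤
      catalan n * (4 * n) := by
  rw [degreeTotal_eq_sum_trees, Nat.cast_sum]
  refine abs_sum_trees_sub_le n _ _ _ fun t ht => ?_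
  obtain ⟨m, rfl⟩ := Nat.exists_eq_add_of_le' hn
  rw [tripleSum, ht, Nat.cast_sum]
  have := abs_sum_sub_sum_interior_le (fun i => (columnCount 2 (m + 2) (treeWord t) i : ℝ))
    (fun i => (peakHeight (treeWord t i) (treeWord t (i + 1)) (treeWord t (i + 2)) : ℝ)) m 2
    (m + 2 : ℕ) (columnCount_treeWord_le ht _ (by omega)) (columnCount_treeWord_le ht _ (by omega))
    (fun i hi => columnCount_two_interior _ _ (by omega))
  refine this.trans ?_
  push_cast
  linarith [(Nat.cast_nonneg m : (0 : ℝ) ≤ m)]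

theorem abs_degreeTotal_three_sub_le (n : ℕ) (hn : 2 ≤ n) :
    |(degreeTotal 3 n : ℝ) - (∑ t ∈ treesOfNumNodesEq n, tripleSum exposedHeight t -
      2 * ∑ t ∈ treesOfNumNodesEq n, tripleSum peakHeight t)| ≤ catalan n * (4 * n) := by
  rw [degreeTotal_eq_sum_trees, Nat.cast_sum, mul_sum, ← sum_sub_distrib]
  refine abs_sum_trees_sub_le n _ _ _ fun t ht => ?_
  obtain ⟨m, rfl⟩ := Nat.exists_eq_add_of_le' hn
  rw [tripleSum, tripleSum, ht, Nat.cast_sum, mul_sum, ← sum_sub_distrib]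
  refine (abs_sum_sub_sum_interior_le (fun i => (columnCount 3 (m + 2) (treeWord t) i : ℝ))
    _ m 2
    (m + 2 : ℕ) (columnCount_treeWord_le ht _ (by omega)) (columnCount_treeWord_le ht _ (by omega))
    (fun i hi => columnCount_three_interior _ _ (by omega))).trans ?_
  push_cast
  linarith [(Nat.cast_nonneg m : (0 : ℝ) ≤ m)]

theorem abs_degreeTotal_four_sub_le (n : ℕ) (hn : 2 ≤ n) :
    |(degreeTotal 4 n : ℝ) - gridV n - (∑ t ∈ treesOfNumNodesEq n, tripleSum peakHeight t -
      ∑ t ∈ treesOfNumNodesEq n, tripleSum exposedHeight t)| ≤ catalan n * (4 * n) := by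
  rw [degreeTotal_eq_sum_trees, ← vertexTotal_eq_gridV, vertexTotal_eq_sum_trees, Nat.cast_sum,
    Nat.cast_sum, ← sum_sub_distrib, ← sum_sub_distrib]
  refine abs_sum_trees_sub_le n _ _ _ fun t ht => ?_
  obtain ⟨m, rfl⟩ := Nat.exists_eq_add_of_le' hn
  rw [tripleSum, tripleSum, ht, Nat.cast_sum, Nat.cast_sum, ← sum_sub_distrib, ← sum_sub_distrib]
  have hend : ∀ i < m + 2, |(columnCount 4 (m + 2) (treeWord t) i : ℝ) -
      ((treeWord t i + 1 : ℕ) : ℝ)| ≤ (m + 2 : ℕ) := by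
    intro i hi
    have h₁ : (columnCount 4 (m + 2) (treeWord t) i : ℝ) ≤ (treeWord t i + 1 : ℕ) := by
      exact_mod_cast columnCount_le 4 (m + 2) (treeWord t) i
    have h₂ : ((treeWord t i + 1 : ℕ) : ℝ) ≤ (m + 2 : ℕ) := by
      exact_mod_cast ht ▸ treeWord_lt t i (by omega)
    have h₃ : (0 : ℝ) ≤ columnCount 4 (m + 2) (treeWord t) i := Nat.cast_nonneg _
    rw [abs_le]
    constructor <;> linarith
  refine (abs_sum_sub_sum_interior_le (fun i => (columnCount 4 (m + 2) (treeWord t) i : ℝ) -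
      ((treeWord t i + 1 : ℕ) : ℝ)) _ m 2 (m + 2 : ℕ) (hend _ (by omega)) (hend _ (by omega))
    (fun i hi => by
      push_cast
      exact columnCount_four_interior _ _ (by omega))).trans ?_
  push_cast
  linarith [(Nat.cast_nonneg m : (0 : ℝ) ≤ m)]

/-! ### Recursions at the root of a tree. -/

/-- The contribution to `tripleSum f` of a node whose left and right children are `L` and `R` by
the triple that ends at the root. -/
def leftEnd (f : ℕ → ℕ → ℕ → ℕ) (L R : BinaryTree Unit) : ℝ :=
  if 2 ≤ L.numNodes then
    (f (treeWord L (L.numNodes - 2) + (R.numNodes + 1))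
      (treeWord L (L.numNodes - 1) + (R.numNodes + 1)) 0 : ℝ) else 0

/-- The contribution to `tripleSum f` of a node with right child `R` by the triple that starts at
the root. -/
def rightEnd (f : ℕ → ℕ → ℕ → ℕ) (R : BinaryTree Unit) : ℝ :=
  if 2 ≤ R.numNodes then (f 0 (treeWord R 0 + 1) (treeWord R 1 + 1) : ℝ) else 0

theorem sum_right_triples (f : ℕ → ℕ → ℕ → ℕ)
    (hf : ∀ a b c k, f (a + k) (b + k) (c + k) = f a b c) (u : Unit) (L R : BinaryTree Unit) :
    ∑ k ∈ range (R.numNodes - 1), (f (treeWord (.node u L R) (L.numNodes + k))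
      (treeWord (.node u L R) (L.numNodes + k + 1))
      (treeWord (.node u L R) (L.numNodes + k + 2)) : ℝ) = tripleSum f R + rightEnd f R := by
  have h₁ := treeWord_node_root u L R
  have h₂ := treeWord_node_right u L R
  rw [tripleSum, rightEnd]
  rcases hb : R.numNodes with _ | _ | b
  · simp
  · simp
  · rw [show b + 1 + 1 - 1 = b + 1 by omega, show b + 1 + 1 - 2 = b by omega,
      if_pos (by omega), sum_range_succ']
    congr 1
    · refine sum_congr rfl fun k _ => ?_
      have e₀ := h₂ k
      have e₁ := h₂ (k + 1)
      have e₂ := h₂ (k + 2)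
      rw [show L.numNodes + (k + 1) = L.numNodes + 1 + k by ring, e₀,
        show L.numNodes + 1 + k + 1 = L.numNodes + 1 + (k + 1) by ring, e₁,
        show L.numNodes + 1 + k + 2 = L.numNodes + 1 + (k + 2) by ring, e₂, hf]
    · have e₀ := h₂ 0
      have e₁ := h₂ 1
      rw [add_zero] at e₀
      rw [add_zero, h₁, e₀, show L.numNodes + 2 = L.numNodes + 1 + 1 by ring, e₁]

/-- Triples inside one subtree's word are merely shifted, which `f` ignores, and the triple centred
at the root vanishes by `hf₀`. Only the triples ending or starting at the root remain. -/
theorem tripleSum_node (f : ℕ → ℕ → ℕ → ℕ)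
    (hf : ∀ a b c k, f (a + k) (b + k) (c + k) = f a b c) (hf₀ : ∀ a c, f a 0 c = 0)
    (u : Unit) (L R : BinaryTree Unit) :
    tripleSum f (.node u L R) =
      tripleSum f L + tripleSum f R + leftEnd f L R + rightEnd f R := by
  have hR := sum_right_triples f hf u L R
  have hroot := treeWord_node_root u L R
  -- The triples start at the last letter of the left word; the first of them is centred at the root
  -- and contributes nothing.
  have hmid : ∀ a, L.numNodes = a + 1 → ∑ k ∈ range R.numNodes,
      (f (treeWord (.node u L R) (a + k)) (treeWord (.node u L R) (a + k + 1))
      (treeWord (.node u L R) (a + k + 2)) : ℝ) = tripleSum f R + rightEnd f R := by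
    intro a ha
    rw [← hR, ha]
    rcases R.numNodes with _ | b
    · simp
    · rw [sum_range_succ', add_tsub_cancel_right]
      rw [ha] at hroot
      simp only [add_zero, hroot, hf₀, Nat.cast_zero]
      refine sum_congr rfl fun k _ => ?_
      rw [show a + (k + 1) = a + 1 + k by ring]
  have hn : (BinaryTree.node u L R).numNodes - 2 = L.numNodes + R.numNodes - 1 := by
    simp only [numNodes]; omega
  rcases ha : L.numNodes with _ | _ | a
  · have hL : tripleSum f L = 0 := by simp [tripleSum, ha]
    have hE : leftEnd f L R = 0 := by simp [leftEnd, ha]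
    rw [hL, hE, zero_add, add_zero, ← hR, tripleSum, hn, ha]
    simp
  · have hL : tripleSum f L = 0 := by simp [tripleSum, ha]
    have hE : leftEnd f L R = 0 := by simp [leftEnd, ha]
    rw [hL, hE, zero_add, add_zero, ← hmid 0 ha, tripleSum, hn, ha]
    simp
  · have hmid' := hmid (a + 1) ha
    rw [tripleSum, hn, ha, show a + 1 + 1 + R.numNodes - 1 = a + 1 + R.numNodes by omega,
      sum_range_add, hmid', sum_range_succ, tripleSum.eq_1 f L, ha, leftEnd, ha,
      if_pos (by omega), show a + 1 + 1 - 2 = a by omega, show a + 1 + 1 - 1 = a + 1 by omega]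
    rw [ha] at hroot
    rw [hroot, treeWord_node_left _ _ _ (by omega), treeWord_node_left _ _ _ (by omega)]
    have : ∀ i ∈ range a, (f (treeWord (.node u L R) i) (treeWord (.node u L R) (i + 1))
        (treeWord (.node u L R) (i + 2)) : ℝ) =
        f (treeWord L i) (treeWord L (i + 1)) (treeWord L (i + 2)) := by
      intro i hi
      rw [mem_range] at hi
      rw [treeWord_node_left _ _ _ (by omega), treeWord_node_left _ _ _ (by omega),
        treeWord_node_left _ _ _ (by omega), hf]
    rw [sum_congr rfl this]
    ring

/-- A function of the last two letters of the word of a tree. -/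
def lastTwo (φ : ℕ → ℕ → ℕ) (t : BinaryTree Unit) : ℝ :=
  if 2 ≤ t.numNodes then (φ (treeWord t (t.numNodes - 2)) (treeWord t (t.numNodes - 1)) : ℝ) else 0

/-- A function of the first two letters of the word of a tree. -/
def firstTwo (φ : ℕ → ℕ → ℕ) (t : BinaryTree Unit) : ℝ :=
  if 2 ≤ t.numNodes then (φ (treeWord t 0) (treeWord t 1) : ℝ) else 0

/-- The last letter of the word of a tree, counted from one. -/
def lastLetter (t : BinaryTree Unit) : ℝ :=
  if 1 ≤ t.numNodes then (treeWord t (t.numNodes - 1) : ℝ) + 1 else 0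

/-- The first letter of the word of a tree, counted from one. -/
def firstLetter (t : BinaryTree Unit) : ℝ :=
  if 1 ≤ t.numNodes then (treeWord t 0 : ℝ) + 1 else 0

theorem treeWord_of_numNodes_eq_one {t : BinaryTree Unit} (ht : t.numNodes = 1) :
    treeWord t 0 = 0 := by
  have := treeWord_lt t 0 (by omega)
  omega

/-- The recursion follows the right spine. An empty right subtree puts the minimum last, and a
single node makes the last two letters `0, 1`. -/
theorem lastTwo_node (φ : ℕ → ℕ → ℕ) (hφ : ∀ a b k, φ (a + k) (b + k) = φ a b)
    (hφ₀ : ∀ a, φ a 0 = 0) (u : Unit) (L R : BinaryTree Unit) :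
    lastTwo φ (.node u L R) = lastTwo φ R + (if R.numNodes = 1 then 1 else 0) * φ 0 1 := by
  have h₁ := treeWord_node_root u L R
  have h₂ := treeWord_node_right u L R
  rw [lastTwo, lastTwo, numNodes]
  rcases hb : R.numNodes with _ | _ | b
  · simp only [add_zero, add_tsub_cancel_right, h₁, hφ₀]
    simp
  · have e := h₂ 0
    rw [add_zero, treeWord_of_numNodes_eq_one hb, zero_add] at e
    rw [if_pos (by omega), show L.numNodes + (0 + 1) + 1 - 2 = L.numNodes by omega,
      show L.numNodes + (0 + 1) + 1 - 1 = L.numNodes + 1 by omega, h₁, e]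
    simp
  · rw [if_pos (by omega), if_pos (by omega), if_neg (by omega),
      show L.numNodes + (b + 1 + 1) + 1 - 2 = L.numNodes + 1 + b by omega,
      show L.numNodes + (b + 1 + 1) + 1 - 1 = L.numNodes + 1 + (b + 1) by omega, h₂, h₂, hφ]
    simp

theorem firstTwo_node (φ : ℕ → ℕ → ℕ) (hφ : ∀ a b k, φ (a + k) (b + k) = φ a b)
    (hφ₀ : ∀ a, φ 0 a = 0) (u : Unit) (L R : BinaryTree Unit) :
    firstTwo φ (.node u L R) =
      firstTwo φ L + (if L.numNodes = 1 then 1 else 0) * φ (R.numNodes + 1) 0 := by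
  have h₁ := treeWord_node_root u L R
  rw [firstTwo, firstTwo, numNodes]
  rcases ha : L.numNodes with _ | _ | a
  · rw [ha] at h₁
    simp [h₁, hφ₀]
  · rw [ha, zero_add] at h₁
    have e := treeWord_node_left u L R (i := 0) (by omega)
    rw [treeWord_of_numNodes_eq_one ha, zero_add] at e
    rw [if_pos (by omega), e, h₁]
    simp
  · rw [treeWord_node_left _ _ _ (by omega), treeWord_node_left _ _ _ (by omega), hφ,
      if_pos (by omega), if_pos (by omega), if_neg (by omega)]
    simp

theorem lastLetter_node (u : Unit) (L R : BinaryTree Unit) :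
    lastLetter (.node u L R) = lastLetter R + 1 := by
  have h₁ := treeWord_node_root u L R
  have h₂ := treeWord_node_right u L R
  rw [lastLetter, lastLetter, numNodes, if_pos (by omega), add_tsub_cancel_right]
  rcases hb : R.numNodes with _ | b
  · simp [h₁]
  · rw [if_pos (by omega), show L.numNodes + (b + 1) = L.numNodes + 1 + b by omega, h₂,
      add_tsub_cancel_right]
    push_cast
    ring

theorem firstLetter_node (u : Unit) (L R : BinaryTree Unit) :
    firstLetter (.node u L R) = firstLetter L + (if 1 ≤ L.numNodes then 1 else 0) *
      ((R.numNodes : ℝ) + 1) + (if L.numNodes = 0 then 1 else 0) := by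
  have h₁ := treeWord_node_root u L R
  rw [firstLetter, firstLetter, numNodes, if_pos (by omega)]
  rcases ha : L.numNodes with _ | a
  · rw [ha] at h₁
    simp [h₁]
  · rw [treeWord_node_left _ _ _ (by omega), if_pos (by omega), if_pos (by omega),
      if_neg (by omega)]
    push_cast
    ring

theorem peakIndicator_add (a b c k : ℕ) :
    peakIndicator (a + k) (b + k) (c + k) = peakIndicator a b c := by
  simp [peakIndicator]

theorem peakHeight_add (a b c k : ℕ) :
    peakHeight (a + k) (b + k) (c + k) = peakHeight a b c := by
  unfold peakHeight; omega

theorem exposedHeight_add (a b c k : ℕ) :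
    exposedHeight (a + k) (b + k) (c + k) = exposedHeight a b c := by
  unfold exposedHeight; omega

/-- Indicator of an ascent. -/
def ascent (a b : ℕ) : ℕ := if a < b then 1 else 0

theorem tripleSum_peakIndicator_node (u : Unit) (L R : BinaryTree Unit) :
    tripleSum peakIndicator (.node u L R) = tripleSum peakIndicator L + tripleSum peakIndicator R +
      lastTwo ascent L + firstTwo (fun a b => ascent b a) R := by
  rw [tripleSum_node _ peakIndicator_add (by simp [peakIndicator])]
  congr 1
  · congr 1
    simp only [leftEnd, lastTwo, peakIndicator, ascent]
    simp
  · simp only [rightEnd, firstTwo, peakIndicator, ascent]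
    simp

theorem tripleSum_peakHeight_node (u : Unit) (L R : BinaryTree Unit) :
    tripleSum peakHeight (.node u L R) = tripleSum peakHeight L + tripleSum peakHeight R +
      lastTwo (fun a b => b - a) L + firstTwo (fun a b => a - b) R := by
  rw [tripleSum_node _ peakHeight_add (by simp [peakHeight])]
  congr 1
  · congr 1
    simp only [leftEnd, lastTwo, peakHeight, Nat.max_zero, Nat.add_sub_add_right]
  · simp only [rightEnd, firstTwo, peakHeight]
    simp

/-- At the triple ending at the root, the last letter of the left word drops to `0` from a height
raised by `R.numNodes + 1`; this is the only term coupling both subtrees. The indicators of size 1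
cancel `lastLetter` and `firstLetter` on one-node trees, where no such triple exists. -/
theorem tripleSum_exposedHeight_node (u : Unit) (L R : BinaryTree Unit) :
    tripleSum exposedHeight (.node u L R) = tripleSum exposedHeight L + tripleSum exposedHeight R +
      (lastTwo (fun a b => b - a) L + (lastLetter L - (if L.numNodes = 1 then 1 else 0)) +
        (if 2 ≤ L.numNodes then 1 else 0) * (R.numNodes : ℝ)) +
      ((firstLetter R - (if R.numNodes = 1 then 1 else 0)) + firstTwo (fun a b => a - b) R) := by
  rw [tripleSum_node _ exposedHeight_add (by simp [exposedHeight])]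
  congr 1
  · congr 1
    simp only [leftEnd, lastTwo, exposedHeight, lastLetter, Nat.add_sub_add_right]
    rcases ha : L.numNodes with _ | _ | a
    · simp
    · simp [treeWord_of_numNodes_eq_one ha]
    · simp
      ring
  · simp only [rightEnd, firstTwo, exposedHeight, firstLetter]
    rcases hb : R.numNodes with _ | _ | b
    · simp
    · simp [treeWord_of_numNodes_eq_one hb]
    · simp

/-! ### Generating functions. -/

/-- The generating function of a statistic on binary trees. -/
noncomputable def treeSeries (F : BinaryTree Unit → ℝ) : PowerSeries ℝ :=
  PowerSeries.mk fun n => ∑ t ∈ treesOfNumNodesEq n, F t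

/-- The generating function of a statistic on pairs of binary trees. -/
noncomputable def pairSeries (G : BinaryTree Unit → BinaryTree Unit → ℝ) : PowerSeries ℝ :=
  PowerSeries.mk fun n => ∑ p ∈ antidiagonal n,
    ∑ L ∈ treesOfNumNodesEq p.1, ∑ R ∈ treesOfNumNodesEq p.2, G L R

theorem pairSeries_mul (F G : BinaryTree Unit → ℝ) :
    pairSeries (fun L R => F L * G R) = treeSeries F * treeSeries G := by
  ext n
  simp [pairSeries, treeSeries, PowerSeries.coeff_mul, sum_mul_sum]

theorem pairSeries_add (F G : BinaryTree Unit → BinaryTree Unit → ℝ) :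
    pairSeries (fun L R => F L R + G L R) = pairSeries F + pairSeries G := by
  ext n
  simp [pairSeries, sum_add_distrib]

theorem treeSeries_sub (F G : BinaryTree Unit → ℝ) :
    treeSeries (fun t => F t - G t) = treeSeries F - treeSeries G := by
  ext n
  simp [treeSeries, sum_sub_distrib]

theorem sum_treesOfNumNodesEq_succ (n : ℕ) (F : BinaryTree Unit → ℝ) :
    ∑ t ∈ treesOfNumNodesEq (n + 1), F t = ∑ p ∈ antidiagonal n,
      ∑ L ∈ treesOfNumNodesEq p.1, ∑ R ∈ treesOfNumNodesEq p.2, F (.node () L R) := by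
  rw [treesOfNumNodesEq_succ, sum_biUnion]
  · refine sum_congr rfl fun p _ => ?_
    rw [pairwiseNode, sum_map, sum_product]
    rfl
  · simp_rw [Set.PairwiseDisjoint, Set.Pairwise, disjoint_left]
    aesop

theorem treeSeries_eq (F : BinaryTree Unit → ℝ) :
    treeSeries F = PowerSeries.C (F .nil) + X * pairSeries fun L R => F (.node () L R) := by
  ext n
  cases n with
  | zero => simp [treeSeries]
  | succ n =>
    rw [map_add, PowerSeries.coeff_succ_X_mul, PowerSeries.coeff_C, if_neg (by omega), zero_add]
    simp only [treeSeries, pairSeries, PowerSeries.coeff_mk]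
    exact sum_treesOfNumNodesEq_succ n F

theorem treeSeries_numNodes (φ : ℕ → ℝ) :
    treeSeries (fun t => φ t.numNodes) = PowerSeries.mk fun n => catalan n * φ n := by
  ext n
  simp only [treeSeries, PowerSeries.coeff_mk]
  rw [sum_congr rfl fun t ht => by rw [mem_treesOfNumNodesEq.1 ht], sum_const,
    treesOfNumNodesEq_card_eq_catalan, nsmul_eq_mul]

/-- The generating function of the Catalan numbers. -/
noncomputable def catSeries : PowerSeries ℝ := PowerSeries.mk fun n => (catalan n : ℝ)

/-- The generating function of the central binomial coefficients. -/
noncomputable def centralSeries : PowerSeries ℝ := PowerSeries.mk fun n => (n.centralBinom : ℝ)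

theorem treeSeries_one : treeSeries (fun _ => 1) = catSeries := by
  rw [treeSeries_numNodes fun _ => 1]
  simp [catSeries]

theorem treeSeries_numNodes_eq_one :
    treeSeries (fun t => if t.numNodes = 1 then 1 else 0) = X := by
  rw [treeSeries_numNodes fun n => if n = 1 then 1 else 0]
  ext n
  rw [PowerSeries.coeff_mk, PowerSeries.coeff_X]
  split_ifs with h
  · simp [h]
  · simp

theorem treeSeries_numNodes_eq_zero :
    treeSeries (fun t => if t.numNodes = 0 then 1 else 0) = 1 := by
  rw [treeSeries_numNodes fun n => if n = 0 then 1 else 0]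
  ext n
  rw [PowerSeries.coeff_mk, PowerSeries.coeff_one]
  split_ifs with h
  · simp [h]
  · simp

theorem treeSeries_one_le_numNodes :
    treeSeries (fun t => if 1 ≤ t.numNodes then 1 else 0) = catSeries - 1 := by
  rw [← treeSeries_one, ← treeSeries_numNodes_eq_zero, ← treeSeries_sub]
  congr 1
  ext t
  rcases t.numNodes with _ | n <;> simp

theorem treeSeries_two_le_numNodes :
    treeSeries (fun t => if 2 ≤ t.numNodes then 1 else 0) = catSeries - 1 - X := by
  rw [← treeSeries_one_le_numNodes, ← treeSeries_numNodes_eq_one, ← treeSeries_sub]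
  congr 1
  ext t
  rcases t.numNodes with _ | _ | n <;> simp

theorem treeSeries_numNodes_add_one :
    treeSeries (fun t => (t.numNodes : ℝ) + 1) = centralSeries := by
  rw [treeSeries_numNodes fun n => (n : ℝ) + 1]
  ext n
  have : ((n : ℝ) + 1) * catalan n = n.centralBinom := by
    exact_mod_cast succ_mul_catalan_eq_centralBinom n
  simp [centralSeries, ← this, mul_comm]

theorem treeSeries_numNodes_cast :
    treeSeries (fun t => (t.numNodes : ℝ)) = centralSeries - catSeries := by
  rw [← treeSeries_numNodes_add_one, ← treeSeries_one, ← treeSeries_sub]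
  simp

theorem catSeries_eq : catSeries = 1 + X * catSeries ^ 2 := by
  have h := treeSeries_eq fun _ => 1
  have h' := pairSeries_mul (fun _ => 1) (fun _ => 1)
  simp only [mul_one, treeSeries_one] at h h'
  rw [h'] at h
  simpa [sq] using h

/-- `B = 1 / √(1 - 4X)`, where `√(1 - 4X) = 1 - 2XC`. -/
theorem one_sub_mul_centralSeries : (1 - 2 * X * catSeries) * centralSeries = 1 := by
  -- Differentiating `XC = X + (XC)^2` then yields the claim, since `(XC)' = B` by `(n + 1) *
  -- catalan n = B_n`.
  have hd : PowerSeries.derivative ℝ (X * catSeries) = centralSeries := by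
    ext n
    rw [PowerSeries.coeff_derivative, PowerSeries.coeff_succ_X_mul]
    have : ((n : ℝ) + 1) * catalan n = n.centralBinom := by
      exact_mod_cast succ_mul_catalan_eq_centralBinom n
    simp [centralSeries, catSeries, ← this, mul_comm]
  have h : X * catSeries = X + (X * catSeries) * (X * catSeries) := by
    linear_combination X * catSeries_eq
  have h' := congrArg (PowerSeries.derivative ℝ) h
  rw [map_add, Derivation.leibniz _ (X * catSeries), hd] at h'
  simp only [smul_eq_mul, PowerSeries.derivative_X] at h'
  linear_combination h'

theorem sq_one_sub : (1 - 2 * X * catSeries) ^ 2 = 1 - 4 * X := by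
  linear_combination (-4 * X) * catSeries_eq

theorem one_sub_X_mul_catSeries : (1 - X * catSeries) * catSeries = 1 := by
  linear_combination catSeries_eq

theorem centralSeries_sq_coeff (n : ℕ) : coeff n (centralSeries ^ 2) = (4 : ℝ) ^ n := by
  have h : (1 - 4 * X) * centralSeries ^ 2 = 1 := by
    rw [← sq_one_sub, ← mul_pow, one_sub_mul_centralSeries, one_pow]
  have h' : (1 - 4 * X : PowerSeries ℝ) * PowerSeries.mk (fun n => (4 : ℝ) ^ n) = 1 := by
    ext n
    rw [sub_mul, one_mul, mul_assoc, show (4 : PowerSeries ℝ) = PowerSeries.C (4 : ℝ) from (map_ofNat _ 4).symm,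
      map_sub, PowerSeries.coeff_C_mul]
    cases n with
    | zero => simp
    | succ n =>
      rw [PowerSeries.coeff_succ_X_mul, PowerSeries.coeff_one, if_neg (by omega)]
      simp [pow_succ, mul_comm]
  have : centralSeries ^ 2 = PowerSeries.mk (fun n => (4 : ℝ) ^ n) := by
    linear_combination (PowerSeries.mk (fun n => (4 : ℝ) ^ n)) * h - centralSeries ^ 2 * h'
  rw [this, PowerSeries.coeff_mk]

/-- The recursion reads `T = X * (2 * C * T + E)`, and `B` inverts `1 - 2XC`. -/
theorem treeSeries_eq_of_node {F : BinaryTree Unit → ℝ} (E : BinaryTree Unit →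
    BinaryTree Unit → ℝ) (hnil : F .nil = 0)
    (hnode : ∀ L R, F (.node () L R) = F L + F R + E L R) :
    treeSeries F = X * centralSeries * pairSeries E := by
  have h := treeSeries_eq F
  have h₁ := pairSeries_mul F (fun _ => 1)
  have h₂ := pairSeries_mul (fun _ => 1) F
  simp only [mul_one, one_mul, treeSeries_one] at h₁ h₂
  simp only [hnil, hnode, pairSeries_add, map_zero, zero_add, h₁, h₂] at h
  linear_combination centralSeries * h - treeSeries F * one_sub_mul_centralSeries

theorem pairSeries_left (F : BinaryTree Unit → ℝ) :
    pairSeries (fun L _ => F L) = treeSeries F * catSeries := by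
  have := pairSeries_mul F (fun _ => 1)
  simpa [treeSeries_one] using this

theorem pairSeries_right (F : BinaryTree Unit → ℝ) :
    pairSeries (fun _ R => F R) = catSeries * treeSeries F := by
  have := pairSeries_mul (fun _ => 1) F
  simpa [treeSeries_one] using this

/-- Recursion along a single spine gives `T = X * (C * T + E)`, and `C` inverts `1 - XC`. The same
solution serves for `firstTwo`, `lastLetter` and `firstLetter`. -/
theorem treeSeries_lastTwo (φ : ℕ → ℕ → ℕ) (hφ : ∀ a b k, φ (a + k) (b + k) = φ a b)
    (hφ₀ : ∀ a, φ a 0 = 0) (hφ₁ : φ 0 1 = 1) :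
    treeSeries (lastTwo φ) = X ^ 2 * catSeries ^ 2 := by
  have h := treeSeries_eq (lastTwo φ)
  have hnil : lastTwo φ .nil = 0 := by simp [lastTwo]
  simp only [lastTwo_node φ hφ hφ₀, hφ₁, hnil, Nat.cast_one, mul_one, pairSeries_add,
    pairSeries_right, treeSeries_numNodes_eq_one, map_zero, zero_add] at h
  linear_combination catSeries * h - treeSeries (lastTwo φ) * one_sub_X_mul_catSeries

theorem treeSeries_firstTwo (φ : ℕ → ℕ → ℕ) (hφ : ∀ a b k, φ (a + k) (b + k) = φ a b)
    (hφ₀ : ∀ a, φ 0 a = 0) :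
    treeSeries (firstTwo φ) =
      X ^ 2 * catSeries * treeSeries (fun t => (φ (t.numNodes + 1) 0 : ℝ)) := by
  have h := treeSeries_eq (firstTwo φ)
  have hnil : firstTwo φ .nil = 0 := by simp [firstTwo]
  have hm := pairSeries_mul (fun t => if t.numNodes = 1 then 1 else 0)
    (fun t => (φ (t.numNodes + 1) 0 : ℝ))
  simp only [firstTwo_node φ hφ hφ₀, hnil, pairSeries_add, hm,
    pairSeries_left, treeSeries_numNodes_eq_one, map_zero, zero_add] at h
  linear_combination catSeries * h - treeSeries (firstTwo φ) * one_sub_X_mul_catSeries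

theorem treeSeries_lastLetter : treeSeries lastLetter = catSeries ^ 2 - catSeries := by
  have h := treeSeries_eq lastLetter
  have hnil : lastLetter .nil = 0 := by simp [lastLetter]
  have hm := pairSeries_left fun _ => 1
  simp only [lastLetter_node, hnil, pairSeries_add, hm, pairSeries_right, treeSeries_one, map_zero,
    zero_add] at h
  linear_combination catSeries * h - treeSeries lastLetter * one_sub_X_mul_catSeries -
    catSeries * catSeries_eq

theorem treeSeries_firstLetter : treeSeries firstLetter =
    X * catSeries * ((catSeries - 1) * centralSeries + catSeries) := by
  have h := treeSeries_eq firstLetter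
  have hnil : firstLetter .nil = 0 := by simp [firstLetter]
  have hm := pairSeries_mul (fun t => if 1 ≤ t.numNodes then 1 else 0)
    (fun t => (t.numNodes : ℝ) + 1)
  simp only [firstLetter_node, hnil, pairSeries_add, hm, pairSeries_left, map_zero, zero_add,
    treeSeries_one_le_numNodes, treeSeries_numNodes_add_one, treeSeries_numNodes_eq_zero,
    one_mul] at h
  linear_combination catSeries * h - treeSeries firstLetter * one_sub_X_mul_catSeries

theorem treeSeries_peakIndicator : treeSeries (tripleSum peakIndicator) =
    2 * X ^ 3 * centralSeries * catSeries ^ 3 := by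
  rw [treeSeries_eq_of_node (F := tripleSum peakIndicator)
    (fun L R => lastTwo ascent L + firstTwo (fun a b => ascent b a) R)
    (by simp [tripleSum]) (fun L R => by rw [tripleSum_peakIndicator_node]; ring),
    pairSeries_add, pairSeries_left, pairSeries_right,
    treeSeries_lastTwo _ (by simp [ascent]) (by simp [ascent]) (by simp [ascent]),
    treeSeries_firstTwo _ (by simp [ascent]) (by simp [ascent])]
  simp only [ascent, Nat.succ_pos, if_true, Nat.cast_one, treeSeries_one]
  ring

theorem treeSeries_descentHeight :
    treeSeries (firstTwo fun a b => a - b) = X ^ 2 * catSeries * centralSeries := by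
  rw [treeSeries_firstTwo _ (fun a b k => by omega) (fun a => by omega)]
  simp only [Nat.sub_zero, Nat.cast_add, Nat.cast_one, treeSeries_numNodes_add_one]

theorem treeSeries_peakHeight : treeSeries (tripleSum peakHeight) =
    X * centralSeries * catSeries * (X ^ 2 * catSeries ^ 2 + X ^ 2 * catSeries * centralSeries) := by
  rw [treeSeries_eq_of_node (F := tripleSum peakHeight)
    (fun L R => lastTwo (fun a b => b - a) L + firstTwo (fun a b => a - b) R)
    (by simp [tripleSum]) (fun L R => by rw [tripleSum_peakHeight_node]; ring),
    pairSeries_add, pairSeries_left, pairSeries_right,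
    treeSeries_lastTwo _ (fun a b k => by omega) (fun a => by omega) (by omega),
    treeSeries_descentHeight]
  ring

theorem treeSeries_exposedHeight : treeSeries (tripleSum exposedHeight) =
    X * centralSeries * ((X ^ 2 * catSeries ^ 2 + (catSeries ^ 2 - catSeries - X)) * catSeries +
      (catSeries - 1 - X) * (centralSeries - catSeries) +
      catSeries * (X * catSeries * ((catSeries - 1) * centralSeries + catSeries) - X +
        X ^ 2 * catSeries * centralSeries)) := by
  rw [treeSeries_eq_of_node (F := tripleSum exposedHeight) _ (by simp [tripleSum])
    (fun L R => by rw [tripleSum_exposedHeight_node, add_assoc]),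
    pairSeries_add, pairSeries_add, pairSeries_add, pairSeries_add, pairSeries_left,
    pairSeries_left, pairSeries_right, pairSeries_right, pairSeries_mul, treeSeries_sub,
    treeSeries_sub,
    treeSeries_lastTwo _ (fun a b k => by omega) (fun a => by omega) (by omega),
    treeSeries_descentHeight, treeSeries_lastLetter, treeSeries_firstLetter,
    treeSeries_numNodes_eq_one, treeSeries_two_le_numNodes, treeSeries_numNodes_cast]
  ring

theorem X_mul_catSeries_mul_centralSeries :
    2 * (X * catSeries) * centralSeries = centralSeries - 1 := by
  linear_combination -one_sub_mul_centralSeries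

theorem X_mul_catSeries_sq : (X * catSeries) ^ 2 = X * catSeries - X := by
  linear_combination -X * catSeries_eq

theorem X_mul_centralSeries_sq : 4 * X * centralSeries ^ 2 = centralSeries ^ 2 - 1 := by
  linear_combination centralSeries ^ 2 * sq_one_sub -
    ((1 - 2 * X * catSeries) * centralSeries + 1) * one_sub_mul_centralSeries

theorem catSeries_mul_centralSeries :
    catSeries * centralSeries = 2 * centralSeries - catSeries := by
  linear_combination 2 * centralSeries * catSeries_eq - catSeries * one_sub_mul_centralSeries

theorem four_mul_treeSeries_peakIndicator : 4 * treeSeries (tripleSum peakIndicator) =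
    centralSeries - 1 - 6 * (X * catSeries) + 4 * X := by
  rw [treeSeries_peakIndicator]
  linear_combination (4 * (X * catSeries) ^ 2 + 2 * (X * catSeries) + 1) *
    X_mul_catSeries_mul_centralSeries - 4 * X_mul_catSeries_sq

/-- The `B ^ 2` term isolates the pole at `1/4`; the remaining terms have coefficients `O(B_n)`. -/
theorem sixteen_mul_treeSeries_peakHeight : 16 * treeSeries (tripleSum peakHeight) =
    centralSeries ^ 2 + (2 * centralSeries - 8 * (X * centralSeries) - 3 + 12 * X -
      12 * (X * catSeries)) := by
  rw [treeSeries_peakHeight]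
  linear_combination (8 * (X * catSeries) ^ 2 + 4 * (X * catSeries) + 2 +
    4 * X * (2 * (X * catSeries) * centralSeries + centralSeries - 1)) *
      X_mul_catSeries_mul_centralSeries - 8 * X_mul_catSeries_sq + X_mul_centralSeries_sq

theorem two_mul_treeSeries_exposedHeight : 2 * treeSeries (tripleSum exposedHeight) =
    centralSeries ^ 2 + (2 * catSeries - 2 * catSeries ^ 2 + 3 * X - 5 * (X * centralSeries) - 1) := by
  rw [treeSeries_exposedHeight]
  have h₁ := X_mul_catSeries_mul_centralSeries
  have h₂ := X_mul_centralSeries_sq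
  have h₃ := catSeries_mul_centralSeries
  have h₄ := catSeries_eq
  -- Only the four polynomial relations are needed, so the series become free variables of a
  -- commutative ring.
  generalize catSeries = c at *
  generalize centralSeries = b at *
  generalize (X : PowerSeries ℝ) = x at *
  grind

/-! ### Error terms and the totals up to `O(B_n)`. -/

/-- The power series whose coefficients are bounded by a multiple of the central binomial
coefficients. -/
def centralBounded : Submodule ℝ (PowerSeries ℝ) where
  carrier := {f | ∃ K : ℝ, ∀ n, |coeff n f| ≤ K * n.centralBinom}
  add_mem' := by
    rintro f g ⟨K, hK⟩ ⟨M, hM⟩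
    refine ⟨K + M, fun n => ?_⟩
    rw [map_add, add_mul]
    exact (abs_add_le _ _).trans (add_le_add (hK n) (hM n))
  zero_mem' := ⟨0, by simp⟩
  smul_mem' := by
    rintro a f ⟨K, hK⟩
    refine ⟨|a| * K, fun n => ?_⟩
    rw [PowerSeries.coeff_smul, smul_eq_mul, abs_mul, mul_assoc]
    exact mul_le_mul_of_nonneg_left (hK n) (abs_nonneg a)

theorem centralBinom_le_succ (n : ℕ) : n.centralBinom ≤ (n + 1).centralBinom := by
  have := Nat.succ_mul_centralBinom_succ n
  nlinarith [n.centralBinom_pos]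

theorem centralBinom_succ_le (n : ℕ) : (n + 1).centralBinom ≤ 4 * n.centralBinom := by
  have := Nat.succ_mul_centralBinom_succ n
  nlinarith [n.centralBinom_pos]

theorem X_mul_mem_centralBounded {f : PowerSeries ℝ} (hf : f ∈ centralBounded) :
    X * f ∈ centralBounded := by
  obtain ⟨K, hK⟩ := hf
  have hK₀ : 0 ≤ K := by
    have := (abs_nonneg _).trans (hK 0)
    simpa using this
  refine ⟨K, fun n => ?_⟩
  cases n with
  | zero => simpa using hK₀
  | succ n =>
    rw [PowerSeries.coeff_succ_X_mul]
    refine (hK n).trans (mul_le_mul_of_nonneg_left ?_ hK₀)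
    exact_mod_cast centralBinom_le_succ n

theorem one_mem_centralBounded : (1 : PowerSeries ℝ) ∈ centralBounded := by
  refine ⟨1, fun n => ?_⟩
  have h : (1 : ℝ) ≤ n.centralBinom := by exact_mod_cast n.centralBinom_pos
  rw [PowerSeries.coeff_one]
  split_ifs
  · simpa using h
  · simp

theorem X_mem_centralBounded : (X : PowerSeries ℝ) ∈ centralBounded := by
  simpa using X_mul_mem_centralBounded one_mem_centralBounded

theorem centralSeries_mem_centralBounded : centralSeries ∈ centralBounded :=
  ⟨1, fun n => by simp [centralSeries]⟩

theorem succ_mul_catalan_cast (n : ℕ) : ((n : ℝ) + 1) * catalan n = n.centralBinom := by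
  exact_mod_cast succ_mul_catalan_eq_centralBinom n

theorem catalan_le_centralBinom (n : ℕ) : (catalan n : ℝ) ≤ n.centralBinom := by
  rw [← succ_mul_catalan_cast]
  nlinarith [(Nat.cast_nonneg n : (0 : ℝ) ≤ n), (Nat.cast_nonneg (catalan n) : (0 : ℝ) ≤ catalan n)]

theorem catSeries_mem_centralBounded : catSeries ∈ centralBounded :=
  ⟨1, fun n => by simpa [catSeries] using catalan_le_centralBinom n⟩

/-- The coefficients of `C ^ 2` are the Catalan numbers shifted by one, and `B_{n+1} ≤ 4 * B_n`
absorbs the shift. -/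
theorem catSeries_sq_mem_centralBounded : catSeries ^ 2 ∈ centralBounded := by
  refine ⟨4, fun n => ?_⟩
  have h := congrArg (coeff (n + 1)) catSeries_eq
  rw [map_add, PowerSeries.coeff_succ_X_mul, PowerSeries.coeff_one, if_neg (by omega), zero_add]
    at h
  rw [← h, catSeries, PowerSeries.coeff_mk, Nat.abs_cast]
  refine (catalan_le_centralBinom (n + 1)).trans ?_
  exact_mod_cast centralBinom_succ_le n

theorem ofNat_mul_mem_centralBounded (k : ℕ) [k.AtLeastTwo] {f : PowerSeries ℝ}
    (hf : f ∈ centralBounded) : (OfNat.ofNat k : PowerSeries ℝ) * f ∈ centralBounded := by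
  have h : (OfNat.ofNat k : PowerSeries ℝ) * f = (OfNat.ofNat k : ℝ) • f := by
    rw [PowerSeries.smul_eq_C_mul, map_ofNat]
  rw [h]
  exact Submodule.smul_mem _ _ hf

theorem coeff_ofNat_mul (k : ℕ) [k.AtLeastTwo] (n : ℕ) (f : PowerSeries ℝ) :
    coeff n ((OfNat.ofNat k : PowerSeries ℝ) * f) = (OfNat.ofNat k : ℝ) * coeff n f := by
  rw [← PowerSeries.coeff_C_mul, map_ofNat]

theorem sum_peakHeight_bound : ∃ K : ℝ, ∀ n : ℕ,
    |16 * ∑ t ∈ treesOfNumNodesEq n, tripleSum peakHeight t - 4 ^ n| ≤ K * n.centralBinom := by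
  have hmem : 2 * centralSeries - 8 * (X * centralSeries) - 3 + 12 * X - 12 * (X * catSeries) ∈
      centralBounded := by
    have h3 := ofNat_mul_mem_centralBounded 3 one_mem_centralBounded
    rw [mul_one] at h3
    exact sub_mem (add_mem (sub_mem (sub_mem
      (ofNat_mul_mem_centralBounded 2 centralSeries_mem_centralBounded)
      (ofNat_mul_mem_centralBounded 8 (X_mul_mem_centralBounded centralSeries_mem_centralBounded)))
      h3) (ofNat_mul_mem_centralBounded 12 X_mem_centralBounded))
      (ofNat_mul_mem_centralBounded 12 (X_mul_mem_centralBounded catSeries_mem_centralBounded))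
  obtain ⟨K, hK⟩ := hmem
  refine ⟨K, fun n => ?_⟩
  have h := congrArg (coeff n) sixteen_mul_treeSeries_peakHeight
  rw [coeff_ofNat_mul, map_add, centralSeries_sq_coeff, treeSeries, PowerSeries.coeff_mk] at h
  rw [h, add_sub_cancel_left]
  exact hK n

theorem sum_exposedHeight_bound : ∃ K : ℝ, ∀ n : ℕ,
    |2 * ∑ t ∈ treesOfNumNodesEq n, tripleSum exposedHeight t - 4 ^ n| ≤ K * n.centralBinom := by
  have hmem : 2 * catSeries - 2 * catSeries ^ 2 + 3 * X - 5 * (X * centralSeries) - 1 ∈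
      centralBounded :=
    sub_mem (sub_mem (add_mem (sub_mem
      (ofNat_mul_mem_centralBounded 2 catSeries_mem_centralBounded)
      (ofNat_mul_mem_centralBounded 2 catSeries_sq_mem_centralBounded))
      (ofNat_mul_mem_centralBounded 3 X_mem_centralBounded))
      (ofNat_mul_mem_centralBounded 5 (X_mul_mem_centralBounded centralSeries_mem_centralBounded)))
      one_mem_centralBounded
  obtain ⟨K, hK⟩ := hmem
  refine ⟨K, fun n => ?_⟩
  have h := congrArg (coeff n) two_mul_treeSeries_exposedHeight
  rw [coeff_ofNat_mul, map_add, centralSeries_sq_coeff, treeSeries, PowerSeries.coeff_mk] at h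
  rw [h, add_sub_cancel_left]
  exact hK n

theorem four_mul_sum_peakIndicator (n : ℕ) :
    4 * ∑ t ∈ treesOfNumNodesEq (n + 2), tripleSum peakIndicator t =
      (n + 2).centralBinom - 6 * catalan (n + 1) := by
  have h := congrArg (coeff (n + 2)) four_mul_treeSeries_peakIndicator
  have h4 : coeff (n + 2) (4 * X : PowerSeries ℝ) = 0 := by
    rw [coeff_ofNat_mul, PowerSeries.coeff_X, if_neg (by omega), mul_zero]
  rw [coeff_ofNat_mul, map_add, map_sub, map_sub, coeff_ofNat_mul, h4, PowerSeries.coeff_one,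
    if_neg (by omega), PowerSeries.coeff_succ_X_mul, treeSeries, PowerSeries.coeff_mk,
    centralSeries, PowerSeries.coeff_mk, catSeries, PowerSeries.coeff_mk] at h
  linarith

theorem catalan_mul_le (n : ℕ) : (catalan n : ℝ) * n ≤ n.centralBinom := by
  rw [← succ_mul_catalan_cast]
  nlinarith [(Nat.cast_nonneg (catalan n) : (0 : ℝ) ≤ catalan n)]

/-- The end columns cost `4 * catalan n` and the peak series `(6/4) * catalan (n - 1)`; each Catalan
number is at most `B_n / n`, and `4 + 3/2 ≤ 6`. -/
theorem degreeTotal_one_bound (n : ℕ) (hn : 2 ≤ n) :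
    |(degreeTotal 1 n : ℝ) - n.centralBinom / 4| ≤ 6 * (n.centralBinom / n) := by
  obtain ⟨m, rfl⟩ := Nat.exists_eq_add_of_le' hn
  have h₁ := abs_degreeTotal_one_sub_le (m + 2) hn
  have h₂ := four_mul_sum_peakIndicator m
  have hpos : (0 : ℝ) < (m + 2 : ℕ) := by positivity
  have h₃ : (catalan (m + 2) : ℝ) ≤ (m + 2).centralBinom / (m + 2 : ℕ) := by
    rw [le_div_iff₀ hpos]
    exact catalan_mul_le _
  have h₄ : (catalan (m + 1) : ℝ) ≤ (m + 2).centralBinom / (m + 2 : ℕ) := by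
    rw [le_div_iff₀ hpos]
    have h := succ_mul_catalan_cast (m + 1)
    have h' : ((m + 1).centralBinom : ℝ) ≤ (m + 2).centralBinom := by
      exact_mod_cast centralBinom_le_succ (m + 1)
    push_cast at h ⊢
    linarith
  have h₅ : (0 : ℝ) ≤ catalan (m + 1) := Nat.cast_nonneg _
  rw [abs_le] at h₁ ⊢
  constructor <;> linarith [h₁.1, h₁.2]

theorem degreeTotal_two_bound : ∃ K : ℝ, ∀ n : ℕ, 2 ≤ n →
    |(degreeTotal 2 n : ℝ) - 1 / 16 * 4 ^ n| ≤ K * n.centralBinom := by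
  obtain ⟨K, hK⟩ := sum_peakHeight_bound
  refine ⟨K / 16 + 4, fun n hn => ?_⟩
  have h₁ := abs_degreeTotal_two_sub_le n hn
  have h₂ := hK n
  have h₃ := catalan_mul_le n
  rw [abs_le] at *
  constructor <;> linarith [h₁.1, h₁.2, h₂.1, h₂.2]

/-- Here `3/8 = 1/2 - 2 * (1/16)`, from exposed height minus twice peak height. -/
theorem degreeTotal_three_bound : ∃ K : ℝ, ∀ n : ℕ, 2 ≤ n →
    |(degreeTotal 3 n : ℝ) - 3 / 8 * 4 ^ n| ≤ K * n.centralBinom := by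
  obtain ⟨K, hK⟩ := sum_peakHeight_bound
  obtain ⟨M, hM⟩ := sum_exposedHeight_bound
  refine ⟨K / 8 + M / 2 + 4, fun n hn => ?_⟩
  have h₁ := abs_degreeTotal_three_sub_le n hn
  have h₂ := hK n
  have h₃ := catalan_mul_le n
  have h₄ := hM n
  rw [abs_le] at *
  constructor <;> linarith [h₁.1, h₁.2, h₂.1, h₂.2, h₄.1, h₄.2]

/-- Here `-7/16 = 1/16 - 1/2`, from peak height minus exposed height. -/
theorem degreeTotal_four_bound : ∃ K : ℝ, ∀ n : ℕ, 2 ≤ n →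
    |(degreeTotal 4 n : ℝ) - gridV n - -(7 / 16) * 4 ^ n| ≤ K * n.centralBinom := by
  obtain ⟨K, hK⟩ := sum_peakHeight_bound
  obtain ⟨M, hM⟩ := sum_exposedHeight_bound
  refine ⟨K / 16 + M / 2 + 4, fun n hn => ?_⟩
  have h₁ := abs_degreeTotal_four_sub_le n hn
  have h₂ := hK n
  have h₃ := catalan_mul_le n
  have h₄ := hM n
  rw [abs_le] at *
  constructor <;> linarith [h₁.1, h₁.2, h₂.1, h₂.2, h₄.1, h₄.2]

/-! ### Wallis estimate and asymptotics. -/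

theorem wallis_mul_centralBinom_sq (n : ℕ) :
    Real.Wallis.W n * (2 * n + 1) * (n.centralBinom : ℝ) ^ 2 = (4 ^ n) ^ 2 := by
  induction n with
  | zero => simp [Real.Wallis.W]
  | succ n ih =>
    have h : ((n : ℝ) + 1) * (n + 1).centralBinom = 2 * (2 * n + 1) * n.centralBinom := by
      exact_mod_cast Nat.succ_mul_centralBinom_succ n
    have h' : ((n + 1).centralBinom : ℝ) = 2 * (2 * n + 1) * n.centralBinom / (n + 1) := by
      rw [eq_div_iff (by positivity), ← h, mul_comm]
    rw [Real.Wallis.W_succ, h', pow_succ (4 : ℝ), mul_pow, ← ih]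
    push_cast
    field_simp
    ring

/-- The squared ratio is `W n * (2n + 1)`, and the two-sided bounds on the Wallis product place it
between `π n` and `π n + π / 2`. -/
theorem abs_four_pow_div_sub_sqrt_le (n : ℕ) :
    |(4 : ℝ) ^ n / n.centralBinom - √(Real.pi * n)| ≤ 2 := by
  have hcb : (0 : ℝ) < n.centralBinom := by exact_mod_cast n.centralBinom_pos
  have hn : (0 : ℝ) ≤ n := Nat.cast_nonneg n
  have hsq : ((4 : ℝ) ^ n / n.centralBinom) ^ 2 = Real.Wallis.W n * (2 * n + 1) := by
    rw [div_pow, ← wallis_mul_centralBinom_sq, mul_div_assoc, div_self (by positivity), mul_one]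
  have hpi := Real.pi_pos
  have hpi4 := Real.pi_le_four
  have hr : (0 : ℝ) ≤ (4 : ℝ) ^ n / n.centralBinom := by positivity
  have hs := Real.sqrt_nonneg (Real.pi * n)
  have hss := Real.sq_sqrt (mul_nonneg hpi.le hn)
  have hlow : √(Real.pi * n) ≤ (4 : ℝ) ^ n / n.centralBinom := by
    refine Real.sqrt_le_iff.2 ⟨hr, ?_⟩
    rw [hsq]
    refine le_trans ?_ (mul_le_mul_of_nonneg_right (Real.Wallis.le_W n) (by positivity))
    rw [div_mul_eq_mul_div, div_mul_eq_mul_div, le_div_iff₀ (by positivity)]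
    nlinarith
  have hup : (4 : ℝ) ^ n / n.centralBinom ≤ √(Real.pi * n) + 2 := by
    refine le_of_sq_le_sq ?_ (by positivity)
    rw [hsq]
    refine (mul_le_mul_of_nonneg_right (Real.Wallis.W_le n) (by positivity)).trans ?_
    nlinarith
  rw [abs_le]
  constructor <;> linarith

theorem gridV_eq (n : ℕ) : gridV n = n / 2 * n.centralBinom := by
  rw [gridV, Nat.centralBinom_eq_two_mul_choose]

theorem sqrt_pi_mul_div (n : ℕ) (hn : 1 ≤ n) :
    √(Real.pi * n) / n = √Real.pi * (n : ℝ) ^ (-(1 / 2) : ℝ) := by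
  have h : (0 : ℝ) < n := by exact_mod_cast hn
  rw [Real.sqrt_mul Real.pi_pos.le, mul_div_assoc, Real.sqrt_eq_rpow (n : ℝ),
    div_eq_mul_inv, ← Real.rpow_neg_one, ← Real.rpow_add h]
  norm_num

/-- Dividing `α * 4^n` by `n * B_n / 2` gives `(2α / n) * (√(π n) + O(1))`, while an error `O(B_n)`
becomes `O(1/n)`. -/
theorem isBigO_div_gridV (f : ℕ → ℝ) (α : ℝ)
    (hf : ∃ K : ℝ, ∀ n : ℕ, 2 ≤ n → |f n - α * 4 ^ n| ≤ K * n.centralBinom) :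
    (fun n : ℕ => f n / gridV n - 2 * α * √Real.pi * (n : ℝ) ^ (-(1 / 2) : ℝ))
      =O[Filter.atTop] (fun n : ℕ => 1 / (n : ℝ)) := by
  obtain ⟨K, hK⟩ := hf
  refine IsBigO.of_bound (2 * K + 4 * |α|) ?_
  filter_upwards [Filter.eventually_ge_atTop 2] with n hn
  have hpos : (0 : ℝ) < n := by exact_mod_cast (by omega : 0 < n)
  have hcb : (0 : ℝ) < n.centralBinom := by exact_mod_cast n.centralBinom_pos
  have hsplit : f n / gridV n - 2 * α * √Real.pi * (n : ℝ) ^ (-(1 / 2) : ℝ) =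
      2 * ((f n - α * 4 ^ n) / n.centralBinom) / n +
        2 * (α * ((4 : ℝ) ^ n / n.centralBinom - √(Real.pi * n))) / n := by
    rw [mul_assoc, ← sqrt_pi_mul_div n (by omega), gridV_eq]
    field_simp
    ring
  have h₁ : |(f n - α * 4 ^ n) / n.centralBinom| ≤ K := by
    rw [abs_div, Nat.abs_cast, div_le_iff₀ hcb]
    exact hK n hn
  have h₂ : |α * ((4 : ℝ) ^ n / n.centralBinom - √(Real.pi * n))| ≤ |α| * 2 := by
    rw [abs_mul]
    exact mul_le_mul_of_nonneg_left (abs_four_pow_div_sub_sqrt_le n) (abs_nonneg α)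
  rw [hsplit, ← add_div, Real.norm_eq_abs, Real.norm_eq_abs, abs_div, abs_div, abs_one,
    Nat.abs_cast, mul_one_div]
  gcongr
  refine (abs_add_le _ _).trans ?_
  rw [abs_mul, abs_mul, abs_two]
  linarith

theorem isBigO_degreeTotal_one :
    (fun n : ℕ => (degreeTotal 1 n : ℝ) / gridV n - 1 / (2 * (n : ℝ)))
      =O[Filter.atTop] (fun n : ℕ => 1 / (n : ℝ) ^ 2) := by
  refine IsBigO.of_bound 12 ?_
  filter_upwards [Filter.eventually_ge_atTop 2] with n hn
  have hpos : (0 : ℝ) < n := by exact_mod_cast (by omega : 0 < n)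
  have hcb : (0 : ℝ) < n.centralBinom := by exact_mod_cast n.centralBinom_pos
  have hsplit : (degreeTotal 1 n : ℝ) / gridV n - 1 / (2 * (n : ℝ)) =
      ((degreeTotal 1 n : ℝ) - n.centralBinom / 4) / (n / 2 * n.centralBinom) := by
    rw [gridV_eq]
    field_simp
    ring
  rw [hsplit, Real.norm_eq_abs, Real.norm_eq_abs, abs_div, abs_of_pos (by positivity :
    (0 : ℝ) < n / 2 * n.centralBinom), abs_of_pos (by positivity : (0 : ℝ) < 1 / (n : ℝ) ^ 2),
    div_le_iff₀ (by positivity)]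
  refine (degreeTotal_one_bound n hn).trans (le_of_eq ?_)
  field_simp
  norm_num

theorem isBigO_degreeTotal_four :
    (fun n : ℕ => (degreeTotal 4 n : ℝ) / gridV n
        - (1 - 7 * Real.sqrt Real.pi / 8 * (n : ℝ) ^ (-(1 / 2) : ℝ)))
      =O[Filter.atTop] (fun n : ℕ => 1 / (n : ℝ)) := by
  refine (isBigO_div_gridV _ _ degreeTotal_four_bound).congr' ?_ Filter.EventuallyEq.rfl
  filter_upwards [Filter.eventually_ge_atTop 2] with n hn
  have hpos : (0 : ℝ) < n := by exact_mod_cast (by omega : 0 < n)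
  have hcb : (0 : ℝ) < n.centralBinom := by exact_mod_cast n.centralBinom_pos
  have hV : gridV n ≠ 0 := by rw [gridV_eq]; positivity
  rw [sub_div, div_self hV]
  ring

theorem mainTheorem5 :
    (∀ n : ℕ, (vertexTotal n : ℝ) = gridV n) ∧
    (fun n : ℕ => (degreeTotal 1 n : ℝ) / gridV n - 1 / (2 * (n : ℝ)))
      =O[Filter.atTop] (fun n : ℕ => 1 / (n : ℝ) ^ 2) ∧
    (fun n : ℕ => (degreeTotal 2 n : ℝ) / gridV n
        - Real.sqrt Real.pi / 8 * (n : ℝ) ^ (-(1 / 2) : ℝ))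
      =O[Filter.atTop] (fun n : ℕ => 1 / (n : ℝ)) ∧
    (fun n : ℕ => (degreeTotal 3 n : ℝ) / gridV n
        - 3 * Real.sqrt Real.pi / 4 * (n : ℝ) ^ (-(1 / 2) : ℝ))
      =O[Filter.atTop] (fun n : ℕ => 1 / (n : ℝ)) ∧
    (fun n : ℕ => (degreeTotal 4 n : ℝ) / gridV n
        - (1 - 7 * Real.sqrt Real.pi / 8 * (n : ℝ) ^ (-(1 / 2) : ℝ)))
      =O[Filter.atTop] (fun n : ℕ => 1 / (n : ℝ)) ∧
    Filter.Tendsto (fun n : ℕ => (degreeTotal 4 n : ℝ) / gridV n) Filter.atTop (nhds 1) := by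
  refine ⟨vertexTotal_eq_gridV, isBigO_degreeTotal_one, ?_, ?_, isBigO_degreeTotal_four, ?_⟩
  · refine (isBigO_div_gridV _ _ degreeTotal_two_bound).congr_left fun n => ?_
    ring
  · refine (isBigO_div_gridV _ _ degreeTotal_three_bound).congr_left fun n => ?_
    ring
  · have h₁ := isBigO_degreeTotal_four.trans_tendsto tendsto_one_div_atTop_nhds_zero_nat
    have h₂ : Filter.Tendsto (fun n : ℕ => (n : ℝ) ^ (-(1 / 2) : ℝ)) Filter.atTop (nhds 0) :=
      (tendsto_rpow_neg_atTop (by norm_num)).comp tendsto_natCast_atTop_atTop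
    have h₃ := h₁.add ((h₂.const_mul (7 * Real.sqrt Real.pi / 8)).const_sub 1)
    simpa using h₃
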